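/- **Theorem 3.6 (local unique factorization property).** Let $\mathbb K$ be a field of characteristic $0$ or $\mathbb K=\mathbb Z$, let $\mathbb P=\mathrm{Trop}(Z_1,\dots,Z_m)$ be the tropical semifield, so that the group ring $\mathbb{KP}$ is $\mathbb K[Z_1^{\pm1},\dots,Z_m^{\pm1}]$, and let $\mathcal F$ be the field of rational functions in $n$ independent variables with coefficients in $\mathbb{KP}$. Let $s=(B,X,A)$ be a labeled seed in $\mathcal F$ over $\mathbb P$: $B$ is an $n\times n$ skew-symmetrizable integer matrix, $X=(X_1,\dots,X_n)$ is a tuple in $\mathbb P$ with $X_k=Z_1^{c_{1k}}\cdots Z_m^{c_{mk}}$, and $A=(A_1,\dots,A_n)$ is a free generating set of the field $\mathcal F$ over $\mathbb{KP}$. Assume that the $(n+m)\times n$ extended exchange matrix $\tilde B=\begin{pmatrix}B\\ C\end{pmatrix}$, $C=(c_{ik})$, has full rank $n$. Let $$\mathcal U=\bigcap_t \mathbb{KP}[A_{1;t}^{\pm1},\dots,A_{n;t}^{\pm1}]\subseteq\mathcal F$$ be the associated upper cluster algebra, where $t$ runs over all seeds obtained from $s$ by finite sequences of seed mutations and $A_{1;t},\dots,A_{n;t}$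 is the cluster of $t$. Let $t_0$ be any of these seeds. Call $M=N\cdot L$ a *local factorization* of $M\in\mathcal U$ with respect to $t_0$ if $N,L\in\mathcal U$, $N=A_{1;t_0}^{e_1}\cdots A_{n;t_0}^{e_n}$ for some $e_1,\dots,e_n\in\mathbb Z_{\ge0}$ (that is, $N$ is a cluster monomial in $t_0$), and $L/A_{k;t_0}\notin\mathcal U$ for all $k=1,\dots,n$. Then every nonzero $M\in\mathcal U$ admits exactly one local factorization $M=N\cdot L$ with respect to $t_0$. Moreover, whenever $M=A_{1;t_0}^{e_1}\cdots A_{n;t_0}^{e_n}\cdot L$ is a local factorization with respect to $t_0$, $$e_k=(A_{k;t_0}\,\|\,M)_v:=\max\{s\in\mathbb Z_{\ge0}\mid M/A_{k;t_0}^{s}\in\mathcal U\}\qquad(k=1,\dots,n).$$ -/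

import Mathlib

namespace ClusterAlg

noncomputable section

/-- The tropical semifield `Trop(Z₁, …, Z_m)` as a group: the free abelian multiplicative group on
`Z₁, …, Z_m`, an element `∏ Z_i ^ a_i` being given by its exponent vector `a`. -/
abbrev Trop (m : ℕ) : Type := Multiplicative (Fin m → ℤ)

/-- The exponent of `Z_i` in an element of `Trop(Z₁, …, Z_m)`. -/
def Trop.exponent {m : ℕ} (x : Trop m) (i : Fin m) : ℤ := Multiplicative.toAdd x i

/-- The auxiliary addition: `∏ Z_i ^ a_i ⊕ ∏ Z_i ^ b_i = ∏ Z_i ^ min (a_i, b_i)`. -/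
def Trop.oplus {m : ℕ} (x y : Trop m) : Trop m :=
  Multiplicative.ofAdd fun i => min (x.exponent i) (y.exponent i)

/-- The group algebra `𝕂ℙ` of `ℙ = Trop(Z₁, …, Z_m)` over `𝕂`, that is the ring of Laurent
polynomials in `Z₁, …, Z_m` over `𝕂`. -/
abbrev CoeffRing (K : Type*) [CommRing K] (m : ℕ) : Type _ := MonoidAlgebra K (Trop m)

/-- The ambient field `𝓕`: rational functions in `n` independent variables with coefficients
in `𝕂ℙ`. -/
abbrev AmbientField (K : Type*) [CommRing K] (m n : ℕ) : Type _ :=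
  FractionRing (MvPolynomial (Fin n) (CoeffRing K m))

/-- An integer square matrix `B` is skew-symmetrizable if `S B` is skew-symmetric for some integer
diagonal matrix `S` with strictly positive diagonal entries. -/
def SkewSymmetrizable {n : ℕ} (B : Matrix (Fin n) (Fin n) ℤ) : Prop :=
  ∃ S : Fin n → ℤ, (∀ i, 0 < S i) ∧
    (Matrix.diagonal S * B).transpose = -(Matrix.diagonal S * B)

/-- Mutation of an exchange matrix in direction `k`. -/
def mutateMatrix {n : ℕ} (B : Matrix (Fin n) (Fin n) ℤ) (k : Fin n) :
    Matrix (Fin n) (Fin n) ℤ :=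
  Matrix.of fun i j =>
    if i = k ∨ j = k then -B i j
    else B i j + Int.sign (B i k) * max (B i k * B k j) 0

variable {K : Type*} [CommRing K] [IsDomain K] {m n : ℕ}

/-- `𝕂ℙ` sits in the ambient field; `coeff p` is the image in `𝓕` of `p ∈ ℙ`. -/
def coeff (K : Type*) [CommRing K] [IsDomain K] (n : ℕ) {m : ℕ} (p : Trop m) :
    AmbientField K m n :=
  algebraMap (CoeffRing K m) (AmbientField K m n) (MonoidAlgebra.of K (Trop m) p)

variable (K m n) in
/-- The data `(B, X, A)` of a labeled seed of geometric type: an exchange matrix, the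
coefficient tuple `X` in `ℙ`, and the cluster `A` in `𝓕`. The conditions that make it a seed are
in `SeedData.IsSeed`. -/
structure SeedData where
  B : Matrix (Fin n) (Fin n) ℤ
  X : Fin n → Trop m
  A : Fin n → AmbientField K m n

namespace SeedData

/-- `(B, X, A)` is a labeled seed: `B` is skew-symmetrizable, and `A` is a free generating set of
the field `𝓕` over `𝕂ℙ`, i.e. `A₁, …, A_n` are algebraically independent over `𝕂ℙ` and together
with `𝕂ℙ` they generate `𝓕` as a field. -/
structure IsSeed (s : SeedData K m n) : Prop where
  skewSymmetrizable : SkewSymmetrizable s.B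
  algebraicIndependent : AlgebraicIndependent (CoeffRing K m) s.A
  generates : Subfield.closure
    (Set.range (algebraMap (CoeffRing K m) (AmbientField K m n)) ∪ Set.range s.A) = ⊤

/-- The `k`-th exchange binomial
`X_k / (1 ⊕ X_k) * ∏_{b_jk > 0} A_j ^ b_jk + 1 / (1 ⊕ X_k) * ∏_{b_jk < 0} A_j ^ (-b_jk)`. -/
def exchangeBinomial (s : SeedData K m n) (k : Fin n) : AmbientField K m n :=
  coeff K n (s.X k / Trop.oplus 1 (s.X k)) * ∏ j, s.A j ^ (s.B j k).toNat
    + coeff K n (1 / Trop.oplus 1 (s.X k)) * ∏ j, s.A j ^ (-(s.B j k)).toNat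

/-- Seed mutation `μ_k`. -/
def mutate (s : SeedData K m n) (k : Fin n) : SeedData K m n where
  B := mutateMatrix s.B k
  X := fun i =>
    if i = k then (s.X k)⁻¹
    else s.X i * s.X k ^ max (s.B k i) 0 * Trop.oplus 1 (s.X k) ^ (-(s.B k i))
  A := fun i => if i = k then (s.A k)⁻¹ * s.exchangeBinomial k else s.A i

/-- The coefficient matrix `C = (c_ij)`, of size `m × n`, where `X_j = ∏ Z_i ^ c_ij`. -/
def coeffMatrix (s : SeedData K m n) : Matrix (Fin m) (Fin n) ℤ :=
  Matrix.of fun i j => (s.X j).exponent i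

/-- The extended exchange matrix, of size `(n + m) × n`: the matrix `B` on top of `C`. -/
def extendedMatrix (s : SeedData K m n) : Matrix (Fin n ⊕ Fin m) (Fin n) ℤ :=
  Matrix.fromRows s.B s.coeffMatrix

/-- The extended exchange matrix has full rank, i.e. rank `n` (computed over `ℚ`). -/
def FullRank (s : SeedData K m n) : Prop :=
  (s.extendedMatrix.map (Int.cast : ℤ → ℚ)).rank = n

/-- `t` is one of the seeds of the seed pattern with initial seed `s`, i.e. it is obtained from `s`
by a finite sequence of mutations (equivalently, it sits at some vertex of the `n`-regular
tree). -/
def IsSeedOf (s t : SeedData K m n) : Prop :=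
  Relation.ReflTransGen (fun u v : SeedData K m n => ∃ k, v = u.mutate k) s t

/-- The Laurent polynomial ring `𝓛(t) = 𝕂ℙ[A₁^{±1}, …, A_n^{±1}]` inside `𝓕`. -/
def laurentRing (t : SeedData K m n) : Subalgebra (CoeffRing K m) (AmbientField K m n) :=
  Algebra.adjoin (CoeffRing K m) (Set.range t.A ∪ Set.range fun i => (t.A i)⁻¹)

/-- The upper cluster algebra `𝓤` with initial seed `s`: the intersection of the `𝓛(t)` over all
seeds `t` of the pattern. -/
def upperClusterAlgebra (s : SeedData K m n) :
    Subalgebra (CoeffRing K m) (AmbientField K m n) :=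
  ⨅ t : {t : SeedData K m n // s.IsSeedOf t}, t.1.laurentRing

/-- The monomial `A₁ ^ e₁ ⋯ A_n ^ e_n` in the cluster variables of `t`. -/
def monomial (t : SeedData K m n) (e : Fin n → ℕ) : AmbientField K m n :=
  ∏ i, t.A i ^ e i

/-- Cluster monomials in `t`. -/
def IsClusterMonomial (t : SeedData K m n) (N : AmbientField K m n) : Prop :=
  ∃ e : Fin n → ℕ, N = t.monomial e

end SeedData

open SeedData

/-- The valuation pairing `(a || M)_v = max {s ∈ ℕ | M / a ^ s ∈ 𝓤}`, with values in `ℕ ∪ {∞}`. -/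
def valuationPairing (U : Subalgebra (CoeffRing K m) (AmbientField K m n))
    (a M : AmbientField K m n) : ℕ∞ :=
  ⨆ (s : ℕ) (_ : M / a ^ s ∈ U), (s : ℕ∞)

/-- `M = N * L` is a local factorization of `M` in `𝓤` with respect to the seed `t`: `N` is a cluster
monomial in `t`, both factors lie in `𝓤`, and `L` is not divisible in `𝓤` by any cluster variable
of `t`. -/
structure IsLocalFactorization (U : Subalgebra (CoeffRing K m) (AmbientField K m n))
    (t : SeedData K m n) (M N L : AmbientField K m n) : Prop where
  eq_mul : M = N * L
  mem_left : N ∈ U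
  mem_right : L ∈ U
  isClusterMonomial : t.IsClusterMonomial N
  not_dvd : ∀ k, L / t.A k ∉ U

end

end ClusterAlg

/-!
Write `𝓛(t)` for the Laurent ring of a seed `t`, and call `𝓛(t) ∩ ⋂_k 𝓛(μ_k t)` the upper bound of
`t`. The proof rests on the theorem of Berenstein, Fomin and Zelevinsky that under the full rank
hypothesis the upper bound does not change under mutation, so that the upper cluster algebra `𝓤`
is the upper bound of each of its seeds (`IsFullRankSeed.upperClusterAlgebra_eq_upperBound`).

Granting this, divide `M ∈ 𝓤` by a monomial `∏ A_i ^ e_i` in the cluster of `t₀`. The quotient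
lies in `𝓛(t₀)` anyway, and whether it lies in `𝓛(μ_k t₀)` depends on `e_k` only, because the
other `A_i` are units there. Hence divisibility in `𝓤` by a cluster monomial can be tested one
variable at a time (`IsFullRankSeed.div_monomial_mem_upperBound_iff`). In `𝓛(μ_k t₀)` the variable
`A_k` is a unit times the binomial `1 + ŷ_k`, which is not a unit since the `k`-th column of the
extended exchange matrix is nonzero; Krull's intersection theorem bounds the powers of `A_k` that
divide `M` (`IsFullRankSeed.exists_multiplicity`). A local factorization has to take out each
`A_k` exactly as often as it divides `M` (`isLocalFactorization_iff`), which gives existence,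
uniqueness and the formula for the exponents.

For the invariance of the upper bound it has to be shown that an `M` in `𝓛(t)`, `𝓛(μ_k t)` and
`𝓛(μ_j t)` lies in `T = 𝓛(μ_j μ_k t)`, where `j ≠ k`. Let `P` be the `k`-th exchange binomial of
`t`. From `M ∈ 𝓛(μ_k t)` one gets `M ∈ T[1/A_j]`. From the other two memberships, `M` is a
polynomial in `A_j` and the new variable of `μ_j t`, with coefficients that are Laurent in the
remaining variables (`mem_adjoin_exchange_pair`), and the mutation rule of the `ŷ`-variables
(`yhat_mutate`) places this polynomial in `T[1/P]`. The elements `P` and `A_j` are coprime in `T`: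
if `b_jk ≠ 0`, then `P` is a unit modulo `A_j`; if `b_jk = 0`, both are binomials in monomials
with linearly independent exponents, and a grading that separates these proves coprimality
(`one_add_of_dvd_of_dvd_mul`). So `M ∈ T`.
-/

namespace ClusterAlg

/-! ### Subalgebras of a field: localization and exchange of one variable -/

section Subalgebras

variable {R F : Type*} [CommRing R] [Field F] [Algebra R F]

/-- `x` and `x⁻¹` both lie in the subalgebra `T` of a field; for `x ≠ 0` this says that `x` is a
unit of `T`. -/
def UnitIn (T : Subalgebra R F) (x : F) : Prop := x ∈ T ∧ x⁻¹ ∈ T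

namespace UnitIn

variable {T : Subalgebra R F} {x y : F}

theorem inv (hx : UnitIn T x) : UnitIn T x⁻¹ := ⟨hx.2, by simpa using hx.1⟩

theorem mul (hx : UnitIn T x) (hy : UnitIn T y) : UnitIn T (x * y) :=
  ⟨T.mul_mem hx.1 hy.1, by rw [mul_inv]; exact T.mul_mem hx.2 hy.2⟩

theorem zpow (hx : UnitIn T x) (e : ℤ) : UnitIn T (x ^ e) := by
  obtain ⟨d, rfl | rfl⟩ := e.eq_nat_or_neg
  · exact ⟨by simpa using T.pow_mem hx.1 d, by simpa using T.pow_mem hx.2 d⟩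
  · exact ⟨by simpa using T.pow_mem hx.2 d, by simpa using T.pow_mem hx.1 d⟩

theorem pow (hx : UnitIn T x) (e : ℕ) : UnitIn T (x ^ e) := by
  simpa using hx.zpow e

theorem one : UnitIn T 1 := ⟨T.one_mem, by simp [T.one_mem]⟩

theorem prod {ι : Type*} {s : Finset ι} {f : ι → F} (h : ∀ i ∈ s, UnitIn T (f i)) :
    UnitIn T (∏ i ∈ s, f i) :=
  Finset.prod_induction _ (UnitIn T) (fun _ _ => mul) one h

theorem mono {T' : Subalgebra R F} (h : T ≤ T') (hx : UnitIn T x) : UnitIn T' x :=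
  ⟨h hx.1, h hx.2⟩

theorem mul_mem_iff (hx : UnitIn T x) (hx0 : x ≠ 0) : x * y ∈ T ↔ y ∈ T :=
  ⟨fun h => by simpa [hx0] using T.mul_mem hx.2 h, T.mul_mem hx.1⟩

end UnitIn

/-- If `p ≡ 1` modulo `y`, then `p ^ e ≡ 1` modulo `y` for every integer `e`; here `q = y⁻¹`. -/
theorem zpow_sub_one_mul_mem {S : Subalgebra R F} {p q : F} (hp : UnitIn S p) (hp0 : p ≠ 0)
    (h : (p - 1) * q ∈ S) (e : ℤ) :
    (p ^ e - 1) * q ∈ S := by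
  have hnat : ∀ d : ℕ, (p ^ d - 1) * q ∈ S := by
    intro d
    rw [← mul_geom_sum, mul_right_comm]
    exact S.mul_mem h (S.sum_mem fun i _ => S.pow_mem hp.1 i)
  obtain ⟨d, rfl | rfl⟩ := e.eq_nat_or_neg
  · simpa using hnat d
  · have : (p ^ (-(d : ℤ)) - 1) * q = -((p⁻¹) ^ d * ((p ^ d - 1) * q)) := by
      rw [zpow_neg, zpow_natCast, inv_pow]; field_simp; ring
    rw [this]
    exact S.neg_mem (S.mul_mem (S.pow_mem hp.2 d) (hnat d))

theorem unitIn_prod_zpow {ι : Type*} [Fintype ι] {T : Subalgebra R F} {A : ι → F} {e : ι → ℤ}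
    (h : ∀ i, e i ≠ 0 → UnitIn T (A i)) :
    UnitIn T (∏ i, A i ^ e i) := by
  refine UnitIn.prod fun i _ => ?_
  by_cases hi : e i = 0
  · rw [hi, zpow_zero]; exact UnitIn.one
  · exact (h i hi).zpow _

/-- The localization `T[1/p]`, inside the ambient field, of a subalgebra `T` at an element `p`
of `T`. -/
def away (T : Subalgebra R F) (p : F) (hp : p ∈ T) : Subalgebra R F where
  carrier := {w | ∃ a : ℕ, p ^ a * w ∈ T}
  mul_mem' := by
    rintro v w ⟨a, ha⟩ ⟨b, hb⟩
    refine ⟨a + b, ?_⟩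
    rw [show p ^ (a + b) * (v * w) = (p ^ a * v) * (p ^ b * w) by ring]
    exact T.mul_mem ha hb
  add_mem' := by
    rintro v w ⟨a, ha⟩ ⟨b, hb⟩
    refine ⟨a + b, ?_⟩
    rw [show p ^ (a + b) * (v + w) = p ^ b * (p ^ a * v) + p ^ a * (p ^ b * w) by ring]
    exact T.add_mem (T.mul_mem (T.pow_mem hp _) ha) (T.mul_mem (T.pow_mem hp _) hb)
  algebraMap_mem' r := ⟨0, by simp⟩

theorem le_away {T : Subalgebra R F} {p : F} (hp : p ∈ T) : T ≤ away T p hp :=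
  fun w hw => ⟨0, by simpa using hw⟩

theorem unitIn_away {T : Subalgebra R F} {p : F} (hp : p ∈ T) (hp0 : p ≠ 0) :
    UnitIn (away T p hp) p :=
  ⟨le_away hp hp, 1, by simp [hp0, T.one_mem]⟩

/-- If `p` is a nonzerodivisor modulo `y` in `T`, then `T[1/p] ∩ T[1/y] = T`. -/
theorem mem_of_mem_away_of_mem_away {T : Subalgebra R F} {p y M : F} (hp : p ∈ T) (hy : y ∈ T)
    (hy0 : y ≠ 0) (hpy : ∀ f ∈ T, p * f * y⁻¹ ∈ T → f * y⁻¹ ∈ T)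
    (hMp : M ∈ away T p hp) (hMy : M ∈ away T y hy) : M ∈ T := by
  obtain ⟨a, ha⟩ := hMp
  obtain ⟨b, hb⟩ := hMy
  have key : ∀ (a : ℕ) (w : F), p ^ a * w ∈ T → y * w ∈ T → w ∈ T := by
    intro a
    induction a with
    | zero => intro w h _; simpa using h
    | succ a ih =>
      intro w h hw
      refine ih w ?_ hw
      have := hpy (p ^ a * (y * w)) (T.mul_mem (T.pow_mem hp a) hw) (by
        convert h using 1; field_simp; ring)
      convert this using 1
      field_simp
  induction b with
  | zero => simpa using hb
  | succ b ih =>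
    refine ih (key a _ ?_ ?_)
    · rw [mul_left_comm]; exact T.mul_mem (T.pow_mem hy b) ha
    · rwa [← mul_assoc, ← pow_succ']

/-- Clearing denominators in `S[y, y⁻¹]`. -/
theorem exists_mul_pow_eq_aeval {S : Type*} [CommRing S] [Algebra S F] {y M : F} (hy : y ≠ 0)
    (hM : M ∈ Algebra.adjoin S {y, y⁻¹}) :
    ∃ (d : ℕ) (p : Polynomial S), M * y ^ d = Polynomial.aeval y p := by
  induction hM using Algebra.adjoin_induction with
  | mem x hx =>
    rcases hx with rfl | hx
    · exact ⟨0, Polynomial.X, by simp⟩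
    · rw [Set.mem_singleton_iff] at hx
      subst hx
      exact ⟨1, 1, by simp [hy]⟩
  | algebraMap r => exact ⟨0, Polynomial.C r, by simp⟩
  | add u v _ _ hu hv =>
    obtain ⟨d, p, hp⟩ := hu
    obtain ⟨e, q, hq⟩ := hv
    refine ⟨d + e, p * Polynomial.X ^ e + q * Polynomial.X ^ d, ?_⟩
    simp only [map_add, map_mul, map_pow, Polynomial.aeval_X, ← hp, ← hq]
    ring
  | mul u v _ _ hu hv =>
    obtain ⟨d, p, hp⟩ := hu
    obtain ⟨e, q, hq⟩ := hv
    refine ⟨d + e, p * q, ?_⟩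
    simp only [map_mul, ← hp, ← hq]
    ring

/-- Exchange in one variable: if `z = Q / y` with `y` transcendental over `S ∋ Q`, then
`S[y^{±1}] ∩ S[z^{±1}] = S[y, z]`. Comparing the expansions of an element in powers of `y` and
of `z` shows that the coefficient of `y ^ (-i)` is divisible by `Q ^ i`. -/
theorem mem_adjoin_exchange_pair {S : Type*} [CommRing S] [IsDomain S] [Algebra S F] {y M : F}
    (hy : Transcendental S y) {Q : S} (hQ : Q ≠ 0)
    (h₁ : M ∈ Algebra.adjoin S {y, y⁻¹})
    (h₂ : M ∈ Algebra.adjoin S {y⁻¹ * algebraMap S F Q, (y⁻¹ * algebraMap S F Q)⁻¹}) :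
    M ∈ Algebra.adjoin S {y, y⁻¹ * algebraMap S F Q} := by
  have hinj : Function.Injective (Polynomial.aeval y : Polynomial S →ₐ[S] F) :=
    transcendental_iff_injective.mp hy
  have hy0 : y ≠ 0 := by
    rintro rfl
    exact hy isAlgebraic_zero
  have hQ0 : algebraMap S F Q ≠ 0 := by
    intro h
    apply hQ
    have := @hinj (Polynomial.C Q) 0 (by simpa using h)
    simpa using this
  set z := y⁻¹ * algebraMap S F Q with hz
  have hz0 : z ≠ 0 := mul_ne_zero (inv_ne_zero hy0) hQ0
  have hyz : y * z = algebraMap S F Q := by rw [hz]; field_simp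
  obtain ⟨d, p, hp⟩ := exists_mul_pow_eq_aeval hy0 h₁
  obtain ⟨e, q, hq⟩ := exists_mul_pow_eq_aeval hz0 h₂
  -- A common exponent `D`, so large that the polynomial in `z` has degree at most `2 * D`.
  obtain ⟨D, p, q, hp, hq, hdeg⟩ : ∃ (D : ℕ) (p q : Polynomial S),
      M * y ^ D = Polynomial.aeval y p ∧
      M * z ^ D = Polynomial.aeval z q ∧ q.natDegree < 2 * D + 1 := by
    refine ⟨d + e + q.natDegree, p * Polynomial.X ^ (e + q.natDegree),
      q * Polynomial.X ^ (d + q.natDegree), ?_, ?_, ?_⟩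
    · simp only [map_mul, map_pow, Polynomial.aeval_X, ← hp]; ring
    · simp only [map_mul, map_pow, Polynomial.aeval_X, ← hq]; ring
    · have := Polynomial.natDegree_mul_le (p := q) (q := Polynomial.X ^ (d + q.natDegree))
      have h2 := Polynomial.natDegree_X_pow_le (R := S) (d + q.natDegree)
      omega
  have hpoly : Polynomial.C (Q ^ D) * p = ∑ i ∈ Finset.range (2 * D + 1),
      Polynomial.C (q.coeff i * Q ^ i) * Polynomial.X ^ (2 * D - i) := by
    apply hinj
    have : Polynomial.aeval y (Polynomial.C (Q ^ D) * p) = (M * z ^ D) * y ^ (2 * D) := by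
      rw [map_mul, ← hp, Polynomial.aeval_C, map_pow, ← hyz]; ring
    rw [this, hq, Polynomial.aeval_eq_sum_range' hdeg, Finset.sum_mul, map_sum]
    refine Finset.sum_congr rfl fun i hi => ?_
    have hi' : 2 * D = i + (2 * D - i) := by
      have := Finset.mem_range.mp hi; omega
    rw [map_mul, Polynomial.aeval_C, map_mul, map_pow, map_pow, Polynomial.aeval_X, ← hyz,
      Algebra.smul_def]
    conv_lhs => rw [hi', pow_add]
    ring
  have hcoeff : ∀ i < D, p.coeff i = q.coeff (2 * D - i) * Q ^ (D - i) := by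
    intro i hi
    have h := congrArg (fun r => Polynomial.coeff r i) hpoly
    simp only [Polynomial.coeff_C_mul, Polynomial.finsetSum_coeff,
      Polynomial.coeff_X_pow] at h
    rw [Finset.sum_eq_single (2 * D - i)] at h
    · rw [if_pos (by omega), mul_one, show 2 * D - i = D + (D - i) by omega, pow_add] at h
      apply mul_left_cancel₀ (pow_ne_zero D hQ)
      rw [h, show 2 * D - i = D + (D - i) by omega]; ring
    · intro k hk hne
      have := Finset.mem_range.mp hk
      rw [if_neg (by omega), mul_zero]
    · intro h'
      exact absurd (Finset.mem_range.mpr (by omega)) h'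
  have hM : M = ∑ i ∈ Finset.range (p.natDegree + 1),
      algebraMap S F (p.coeff i) * y ^ i / y ^ D := by
    rw [← Finset.sum_div, eq_div_iff (pow_ne_zero D hy0), hp, Polynomial.aeval_eq_sum_range]
    simp only [Algebra.smul_def]
  rw [hM]
  have hyW : y ∈ Algebra.adjoin S {y, z} := Algebra.subset_adjoin (by simp)
  have hzW : z ∈ Algebra.adjoin S {y, z} := Algebra.subset_adjoin (by simp)
  refine Subalgebra.sum_mem _ fun i _ => ?_
  rcases lt_or_ge i D with hi | hi
  · have : algebraMap S F (p.coeff i) * y ^ i / y ^ D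
        = algebraMap S F (q.coeff (2 * D - i)) * z ^ (D - i) := by
      rw [div_eq_iff (pow_ne_zero D hy0), hcoeff i hi, map_mul, map_pow, ← hyz]
      have : y ^ D = y ^ (D - i) * y ^ i := by rw [← pow_add]; congr 1; omega
      rw [this]; ring
    rw [this]
    exact Subalgebra.mul_mem _ (Subalgebra.algebraMap_mem _ _) (Subalgebra.pow_mem _ hzW _)
  · have : algebraMap S F (p.coeff i) * y ^ i / y ^ D
        = algebraMap S F (p.coeff i) * y ^ (i - D) := by
      rw [div_eq_iff (pow_ne_zero D hy0), mul_assoc, ← pow_add, Nat.sub_add_cancel hi]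
    rw [this]
    exact Subalgebra.mul_mem _ (Subalgebra.algebraMap_mem _ _) (Subalgebra.pow_mem _ hyW _)

/-- The subalgebra generated by all the `A i` with `i ≠ j` and their inverses. -/
def laurentWithout {ι : Type*} (A : ι → F) (j : ι) (R : Type*) [CommRing R] [Algebra R F] :
    Subalgebra R F :=
  Algebra.adjoin R (A '' {j}ᶜ ∪ (fun i => (A i)⁻¹) '' {j}ᶜ)

theorem unitIn_laurentWithout {ι : Type*} (A : ι → F) {i j : ι} (h : i ≠ j) :
    UnitIn (laurentWithout A j R) (A i) :=
  ⟨Algebra.subset_adjoin (.inl ⟨i, h, rfl⟩), Algebra.subset_adjoin (.inr ⟨i, h, rfl⟩)⟩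

theorem transcendental_laurentWithout {ι : Type*} {A : ι → F} (hA : AlgebraicIndependent R A)
    (j : ι) : Transcendental (laurentWithout A j R) (A j) := by
  have h := ((AlgebraicIndependent.iff_transcendental_adjoin_image j).mp hA).2
  intro halg
  refine h (IsAlgebraic.adjoin_of_forall_isAlgebraic (fun x hx => ?_) halg)
  have hAi : ∀ i ≠ j, IsAlgebraic (Algebra.adjoin R (A '' {j}ᶜ)) (A i) := fun i hi =>
    isAlgebraic_algebraMap
      (⟨A i, Algebra.subset_adjoin ⟨i, hi, rfl⟩⟩ : Algebra.adjoin R (A '' {j}ᶜ))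
  obtain ⟨⟨i, hi, rfl⟩ | ⟨i, hi, rfl⟩, _⟩ := hx
  · exact hAi i hi
  · exact (hAi i hi).inv

/-- For a family `A'` obtained from the algebraically independent family `A` by the exchange
`A j ↦ Q / A j`, the intersection of the two Laurent rings is generated by `A j`, `A' j` and the
`A i ^ {±1}` with `i ≠ j`. -/
theorem mem_of_mem_laurent_exchange {ι : Type*} {A A' : ι → F} {Q M : F}
    (hA : AlgebraicIndependent R A) (j : ι) (hQ : Q ∈ laurentWithout A j R) (hQ0 : Q ≠ 0)
    (hj : A' j = (A j)⁻¹ * Q) (hi : ∀ i ≠ j, A' i = A i)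
    (h₁ : M ∈ Algebra.adjoin R (Set.range A ∪ Set.range fun i => (A i)⁻¹))
    (h₂ : M ∈ Algebra.adjoin R (Set.range A' ∪ Set.range fun i => (A' i)⁻¹))
    {S : Subalgebra R F} (hS : ∀ i ≠ j, UnitIn S (A i)) (hSj : A j ∈ S) (hSj' : A' j ∈ S) :
    M ∈ S := by
  have hmem : ∀ {A₁ : ι → F}, (∀ i ≠ j, A₁ i = A i) →
      M ∈ Algebra.adjoin R (Set.range A₁ ∪ Set.range fun i => (A₁ i)⁻¹) →
      M ∈ Algebra.adjoin (laurentWithout A j R) {A₁ j, (A₁ j)⁻¹} := by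
    intro A₁ hA₁ hM
    let L : Subalgebra R F := laurentWithout A j R
    let W : Subalgebra L F := Algebra.adjoin L {A₁ j, (A₁ j)⁻¹}
    have hL : ∀ x ∈ L, x ∈ W.restrictScalars R := fun x hx =>
      W.algebraMap_mem (⟨x, hx⟩ : L)
    have hself : A₁ j ∈ W := Algebra.subset_adjoin (.inl rfl)
    have hself' : (A₁ j)⁻¹ ∈ W := Algebra.subset_adjoin (.inr rfl)
    have hunit : ∀ i ≠ j, UnitIn L (A₁ i) := fun i hij => by
      rw [hA₁ i hij]; exact unitIn_laurentWithout A hij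
    have hle : Algebra.adjoin R (Set.range A₁ ∪ Set.range fun i => (A₁ i)⁻¹) ≤
        W.restrictScalars R := by
      refine Algebra.adjoin_le ?_
      rintro _ (⟨i, rfl⟩ | ⟨i, rfl⟩)
      · by_cases hij : i = j
        · subst hij
          exact hself
        · exact hL _ (hunit i hij).1
      · by_cases hij : i = j
        · subst hij
          exact hself'
        · exact hL _ (hunit i hij).2
    exact hle hM
  have hM₂ := hmem hi h₂
  rw [hj] at hM₂
  have hM := mem_adjoin_exchange_pair (transcendental_laurentWithout hA j)
    (Q := ⟨Q, hQ⟩) (fun h => hQ0 (congrArg Subtype.val h)) (hmem (fun _ _ => rfl) h₁) hM₂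
  have hle : laurentWithout A j R ≤ S := by
    refine Algebra.adjoin_le ?_
    rintro _ (⟨i, hij, rfl⟩ | ⟨i, hij, rfl⟩)
    exacts [(hS i hij).1, (hS i hij).2]
  clear h₁ h₂ hM₂ hmem
  induction hM using Algebra.adjoin_induction with
  | mem x hx =>
    rcases hx with rfl | hx
    · exact hSj
    · rw [Set.mem_singleton_iff.mp hx]
      exact hj ▸ hSj'
  | algebraMap r => exact hle r.2
  | add _ _ _ _ hx hy => exact S.add_mem hx hy
  | mul _ _ _ _ hx hy => exact S.mul_mem hx hy

/-- Replacing `A k` by `P / A k`, where `P ≠ 0` is a polynomial in the other `A i`, preserves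
algebraic independence. -/
theorem algebraicIndependent_exchange {ι : Type*} {A A' : ι → F} {P : F}
    (hA : AlgebraicIndependent R A) (k : ι) (hP : P ∈ Algebra.adjoin R (A '' {k}ᶜ)) (hP0 : P ≠ 0)
    (hk : A' k = (A k)⁻¹ * P) (hi : ∀ i ≠ k, A' i = A i) : AlgebraicIndependent R A' := by
  have h := (AlgebraicIndependent.iff_transcendental_adjoin_image k).mp hA
  have hset : A' '' {k}ᶜ = A '' {k}ᶜ := Set.image_congr fun i h => hi i h
  refine (AlgebraicIndependent.iff_transcendental_adjoin_image k).mpr ⟨?_, ?_⟩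
  · convert h.1 using 2 with i
    exact hi _ i.2
  · rw [hset, hk]
    intro halg
    refine h.2 ?_
    have hPalg : IsAlgebraic (Algebra.adjoin R (A '' {k}ᶜ)) P := isAlgebraic_algebraMap
      (⟨P, hP⟩ : Algebra.adjoin R (A '' {k}ᶜ))
    have := (halg.mul hPalg.inv).inv
    rwa [mul_assoc, mul_inv_cancel₀ hP0, mul_one, inv_inv] at this

end Subalgebras

/-! ### Binomials in group algebras -/

section GroupAlgebra

open LaurentPolynomial in
theorem laurentPolynomial_eq_zero_of_binomial_mul {S : Type*} [CommRing S] {a : S} {r : ℤ}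
    (hr : r ≠ 0) {f : LaurentPolynomial S} (h : (1 + C a * T r) * f = 0) : f = 0 := by
  have hrec : ∀ i : ℤ, f.coeff i = -a * f.coeff (i - r) := by
    intro i
    have h' := congrArg (fun g : LaurentPolynomial S => g.coeff i) h
    rw [add_mul, one_mul, ← single_eq_C_mul_T] at h'
    simp only [AddMonoidAlgebra.coeff_add, AddMonoidAlgebra.coeff_single_mul_apply,
      AddMonoidAlgebra.coeff_zero, Finsupp.coe_add, Pi.add_apply, Finsupp.coe_zero,
      Pi.zero_apply] at h'
    rw [neg_add_eq_sub] at h'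
    linear_combination h'
  have hiter : ∀ (d : ℕ) (i : ℤ), f.coeff i = (-a) ^ d * f.coeff (i - d * r) := by
    intro d
    induction d with
    | zero => intro i; simp
    | succ d ih =>
      intro i
      rw [ih i, hrec (i - d * r), pow_succ, mul_assoc,
        show i - (d : ℤ) * r - r = i - ((d + 1 : ℕ) : ℤ) * r by push_cast; ring]
  refine LaurentPolynomial.ext fun i => ?_
  -- The coefficients at `i - d * r`, for varying `d`, cannot all be nonzero.
  obtain ⟨d, hd⟩ : ∃ d : ℕ, i - d * r ∉ f.coeff.support := by
    by_contra! hcon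
    have hinj : Function.Injective fun d : ℕ => i - d * r := by
      intro d e hde
      have : (d : ℤ) * r = e * r := by simpa using hde
      exact_mod_cast mul_right_cancel₀ hr this
    exact (Set.infinite_of_injective_forall_mem hinj hcon) f.coeff.support.finite_toSet
  rw [hiter d i, Finsupp.notMem_support_iff.mp hd, mul_zero]
  rfl

/-- If a grading `l : G → ℤ` has `l b = 0` and `l a ≠ 0`, then in any quotient of the group algebra
by an ideal generated by `1 + b` the element `1 + a` is not a zero divisor. The grading survives in
the quotient, as a coaction on Laurent polynomials, and turns `1 + a` into a Laurent binomial of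
nonzero degree. -/
theorem map_eq_zero_of_one_add_of_mul {K G S : Type*} [CommRing K] [CommGroup G] [CommRing S]
    (l : G →* Multiplicative ℤ) {a b : G} (hb : l b = 1) (ha : l a ≠ 1)
    (π : MonoidAlgebra K G →+* S)
    (hπ : ∀ f, π f = 0 ↔ 1 + MonoidAlgebra.of K G b ∣ f) {f : MonoidAlgebra K G}
    (h : 1 + MonoidAlgebra.of K G b ∣ (1 + MonoidAlgebra.of K G a) * f) : π f = 0 := by
  let χ : G →* LaurentPolynomial S :=
    { toFun := fun g => LaurentPolynomial.C (π (MonoidAlgebra.of K G g)) *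
        LaurentPolynomial.T (l g).toAdd
      map_one' := by rw [map_one, map_one, map_one, map_one, toAdd_one, LaurentPolynomial.T_zero,
        one_mul]
      map_mul' := fun g g' => by
        simp only [map_mul, toAdd_mul, LaurentPolynomial.T_add]; ring }
  let δ : MonoidAlgebra K G →+* LaurentPolynomial S :=
    MonoidAlgebra.liftNCRingHom
      (LaurentPolynomial.C.comp (π.comp MonoidAlgebra.singleOneRingHom)) χ
      (fun _ _ => Commute.all _ _)
  have hδ : ∀ g, δ (MonoidAlgebra.of K G g) = χ g := fun g => by
    simp only [δ, MonoidAlgebra.of_apply, MonoidAlgebra.liftNCRingHom_single, map_one, one_mul]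
  have hε : (LaurentPolynomial.eval₂ (RingHom.id S) 1).comp δ = π := by
    refine MonoidAlgebra.ringHom_ext (fun r => ?_) (fun g => ?_)
    · simp [δ, MonoidAlgebra.singleOneRingHom]
    · have := hδ g
      rw [MonoidAlgebra.of_apply] at this
      rw [RingHom.comp_apply, this]
      simp [χ]
  have hzero : δ (1 + MonoidAlgebra.of K G b) = 0 := by
    have hmem : π (1 + MonoidAlgebra.of K G b) = 0 := (hπ _).mpr dvd_rfl
    rw [map_add, map_one, hδ]
    simp only [χ, MonoidHom.coe_mk, OneHom.coe_mk, hb, toAdd_one, LaurentPolynomial.T_zero, mul_one]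
    rw [← map_one LaurentPolynomial.C, ← map_add, ← map_one π, ← map_add, hmem, map_zero]
  have hf : δ f = 0 := by
    refine laurentPolynomial_eq_zero_of_binomial_mul (a := π (MonoidAlgebra.of K G a))
      (r := (l a).toAdd) (fun h0 => ha (by simpa using h0)) ?_
    have := map_dvd δ h
    rw [hzero, zero_dvd_iff, map_mul, map_add, map_one, hδ] at this
    exact this
  rw [← hε, RingHom.comp_apply, hf, map_zero]

/-- The binomials `1 + a` and `1 + b` in a group algebra are coprime as soon as some grading
`l : G → ℤ` has `l b = 0` and `l a ≠ 0`. -/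
theorem one_add_of_dvd_of_dvd_mul {K G : Type*} [CommRing K] [CommGroup G]
    (l : G →* Multiplicative ℤ) {a b : G} (hb : l b = 1) (ha : l a ≠ 1) {f : MonoidAlgebra K G}
    (h : 1 + MonoidAlgebra.of K G b ∣ (1 + MonoidAlgebra.of K G a) * f) :
    1 + MonoidAlgebra.of K G b ∣ f := by
  have hπ : ∀ f, Ideal.Quotient.mk (Ideal.span {1 + MonoidAlgebra.of K G b}) f = 0 ↔
      1 + MonoidAlgebra.of K G b ∣ f := fun f => by
    rw [Ideal.Quotient.eq_zero_iff_mem, Ideal.mem_span_singleton]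
  exact (hπ f).mp (map_eq_zero_of_one_add_of_mul l hb ha _ hπ h)

/-- A character with values in an algebraically closed field that takes the value `-1` at `a`
kills `1 + a`. -/
theorem not_isUnit_one_add_of {K σ : Type*} [CommRing K] [IsDomain K]
    {a : Multiplicative (σ → ℤ)} (ha : a ≠ 1) :
    ¬ IsUnit (1 + MonoidAlgebra.of K (Multiplicative (σ → ℤ)) a) := by
  obtain ⟨i, hi⟩ : ∃ i, a.toAdd i ≠ 0 := by
    by_contra! hcon
    exact ha (Multiplicative.toAdd.injective (funext hcon))
  let E := AlgebraicClosure (FractionRing K)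
  obtain ⟨ζ, hζ⟩ : ∃ ζ : Eˣ, ζ ^ (a.toAdd i) = -1 := by
    obtain ⟨x, hx⟩ := IsAlgClosed.exists_pow_nat_eq (-1 : E) (Int.natAbs_pos.mpr hi)
    have hx0 : x ≠ 0 := by
      rintro rfl
      rw [zero_pow (by simpa using hi)] at hx
      exact one_ne_zero (neg_eq_zero.mp hx.symm)
    have hu : (Units.mk0 x hx0) ^ (a.toAdd i).natAbs = -1 := Units.ext (by simpa using hx)
    rcases Int.natAbs_eq (a.toAdd i) with h | h
    · exact ⟨Units.mk0 x hx0, by rw [h, zpow_natCast]; simpa using hu⟩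
    · exact ⟨(Units.mk0 x hx0)⁻¹, by rw [h, inv_zpow', neg_neg, zpow_natCast]; simpa using hu⟩
  let χ : Multiplicative (σ → ℤ) →* E :=
    { toFun := fun g => ((ζ ^ (g.toAdd i) : Eˣ) : E)
      map_one' := by simp
      map_mul' := fun g g' => by simp [zpow_add₀] }
  intro hu
  have h0 : (MonoidAlgebra.lift K E _ χ) (1 + MonoidAlgebra.of K _ a) = 0 := by
    rw [map_add, map_one, MonoidAlgebra.lift_of]
    simp only [χ, MonoidHom.coe_mk, OneHom.coe_mk, hζ]
    simp
  have := hu.map (MonoidAlgebra.lift K E _ χ)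
  rw [h0] at this
  exact not_isUnit_zero this

theorem isNoetherianRing_groupAlgebra {K σ : Type*} [CommRing K] [IsNoetherianRing K] [Finite σ] :
    IsNoetherianRing (MonoidAlgebra K (Multiplicative (σ → ℤ))) :=
  Algebra.FiniteType.isNoetherianRing K _

end GroupAlgebra

noncomputable section

variable {K : Type*} [CommRing K] [IsDomain K] {m n : ℕ}

/-! ### The Laurent ring of a cluster as a group algebra -/

theorem coeff_one : coeff K n (1 : Trop m) = 1 := by
  simp only [coeff, map_one]

theorem coeff_mul (p q : Trop m) : coeff K n (p * q) = coeff K n p * coeff K n q := by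
  simp only [coeff, map_mul]

theorem coeff_ne_zero (p : Trop m) : coeff K n p ≠ 0 := by
  intro h
  have : coeff K n (p * p⁻¹) = 0 := by rw [coeff_mul, h, zero_mul]
  rw [mul_inv_cancel, coeff_one] at this
  exact one_ne_zero this

theorem coeff_inv (p : Trop m) : coeff K n p⁻¹ = (coeff K n p)⁻¹ := by
  refine eq_inv_of_mul_eq_one_left ?_
  rw [← coeff_mul, inv_mul_cancel, coeff_one]

theorem coeff_zpow (p : Trop m) (e : ℤ) : coeff K n (p ^ e) = coeff K n p ^ e := by
  obtain ⟨d, rfl | rfl⟩ := e.eq_nat_or_neg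
  · simp only [zpow_natCast, coeff, map_pow]
  · simp only [zpow_neg, coeff_inv, zpow_natCast]
    simp only [coeff, map_pow]

theorem unitIn_coeff (T : Subalgebra (CoeffRing K m) (AmbientField K m n)) (p : Trop m) :
    UnitIn T (coeff K n p) :=
  ⟨T.algebraMap_mem _, by rw [← coeff_inv]; exact T.algebraMap_mem _⟩

/-- Exponent vectors of Laurent monomials in `A₁, …, A_n` and `Z₁, …, Z_m`. -/
abbrev Exponents (m n : ℕ) : Type := Multiplicative (Fin n ⊕ Fin m → ℤ)

namespace SeedData

variable (t : SeedData K m n)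

theorem unitIn_laurentRing (i : Fin n) : UnitIn t.laurentRing (t.A i) :=
  ⟨Algebra.subset_adjoin (.inl ⟨i, rfl⟩), Algebra.subset_adjoin (.inr ⟨i, rfl⟩)⟩

variable {t} in
theorem laurentRing_le {T : Subalgebra (CoeffRing K m) (AmbientField K m n)}
    (h : ∀ i, UnitIn T (t.A i)) : t.laurentRing ≤ T := by
  refine Algebra.adjoin_le ?_
  rintro _ (⟨i, rfl⟩ | ⟨i, rfl⟩)
  exacts [(h i).1, (h i).2]

/-- The Laurent monomial in `A₁, …, A_n` and `Z₁, …, Z_m` with a given exponent vector. -/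
def laurentMonomial (hA : ∀ i, t.A i ≠ 0) : Exponents m n →* AmbientField K m n where
  toFun v := coeff K n (Multiplicative.ofAdd fun l => v.toAdd (.inr l)) *
    ∏ i, t.A i ^ v.toAdd (.inl i)
  map_one' := by
    have : (Multiplicative.ofAdd fun _ => 0 : Trop m) = 1 := rfl
    simp [this, coeff_one]
  map_mul' v w := by
    have : (Multiplicative.ofAdd fun l => (v * w).toAdd (.inr l) : Trop m)
      = (Multiplicative.ofAdd fun l => v.toAdd (.inr l)) *
        (Multiplicative.ofAdd fun l => w.toAdd (.inr l)) := rfl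
    rw [this, coeff_mul]
    simp only [toAdd_mul, Pi.add_apply, zpow_add₀ (hA _), Finset.prod_mul_distrib]
    ring

theorem laurentMonomial_apply (hA : ∀ i, t.A i ≠ 0) (v : Exponents m n) :
    t.laurentMonomial hA v = coeff K n (Multiplicative.ofAdd fun l => v.toAdd (.inr l)) *
      ∏ i, t.A i ^ v.toAdd (.inl i) := rfl

/-- The Laurent polynomial ring in `n + m` variables, mapped to the ambient field by sending the
variables to `A₁, …, A_n` and `Z₁, …, Z_m`. -/
def laurentHom (hA : ∀ i, t.A i ≠ 0) :
    MonoidAlgebra K (Exponents m n) →+* AmbientField K m n :=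
  MonoidAlgebra.liftNCRingHom
    ((algebraMap (CoeffRing K m) (AmbientField K m n)).comp MonoidAlgebra.singleOneRingHom)
    (t.laurentMonomial hA) (fun _ _ => Commute.all _ _)

theorem laurentHom_single (hA : ∀ i, t.A i ≠ 0) (v : Exponents m n) (r : K) :
    t.laurentHom hA (MonoidAlgebra.single v r) =
      algebraMap (CoeffRing K m) (AmbientField K m n) (MonoidAlgebra.single 1 r) *
        t.laurentMonomial hA v := by
  rw [laurentHom, MonoidAlgebra.liftNCRingHom_single]
  rfl

theorem laurentHom_of (hA : ∀ i, t.A i ≠ 0) (v : Exponents m n) :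
    t.laurentHom hA (MonoidAlgebra.of K _ v) = t.laurentMonomial hA v := by
  rw [MonoidAlgebra.of_apply, laurentHom_single, ← MonoidAlgebra.one_def, map_one, one_mul]

/-- The exponent vectors of the monomials in `Z₁, …, Z_m`. -/
def coeffExponents (m n : ℕ) : Trop m →* Exponents m n where
  toFun p := Multiplicative.ofAdd (Sum.elim 0 p.toAdd)
  map_one' := by
    refine Multiplicative.toAdd.injective (funext fun r => ?_)
    rcases r with i | l <;> rfl
  map_mul' p q := by
    refine Multiplicative.toAdd.injective (funext fun r => ?_)
    rcases r with i | l <;> simp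

/-- The exponent vectors of the monomials in `A₁, …, A_n`. -/
def clusterExponents (m : ℕ) {n : ℕ} (e : Fin n → ℤ) : Exponents m n :=
  Multiplicative.ofAdd (Sum.elim e 0)

theorem laurentMonomial_coeffExponents (hA : ∀ i, t.A i ≠ 0) (p : Trop m) :
    t.laurentMonomial hA (coeffExponents m n p) = coeff K n p := by
  simp [laurentMonomial_apply, coeffExponents]

theorem laurentMonomial_clusterExponents (hA : ∀ i, t.A i ≠ 0) (e : Fin n → ℤ) :
    t.laurentMonomial hA (clusterExponents m e) = ∏ i, t.A i ^ e i := by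
  have : (Multiplicative.ofAdd fun _ => 0 : Trop m) = 1 := rfl
  simp [laurentMonomial_apply, clusterExponents, this, coeff_one]

/-- Polynomials in `A₁, …, A_n` over `𝕂ℙ` as Laurent polynomials in `n + m` variables. -/
def polynomialToLaurent (K : Type*) [CommRing K] (m n : ℕ) :
    MvPolynomial (Fin n) (CoeffRing K m) →+* MonoidAlgebra K (Exponents m n) :=
  MvPolynomial.eval₂Hom (MonoidAlgebra.mapDomainRingHom K (coeffExponents m n))
    fun i => MonoidAlgebra.of K _ (clusterExponents m (Pi.single i 1))

theorem laurentHom_polynomialToLaurent (hA : ∀ i, t.A i ≠ 0)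
    (p : MvPolynomial (Fin n) (CoeffRing K m)) :
    t.laurentHom hA (polynomialToLaurent K m n p) = MvPolynomial.aeval t.A p := by
  suffices h : (t.laurentHom hA).comp (polynomialToLaurent K m n) =
      ((MvPolynomial.aeval t.A : _ →ₐ[CoeffRing K m] AmbientField K m n) :
        MvPolynomial (Fin n) (CoeffRing K m) →+* AmbientField K m n) from
    congrArg (fun φ => φ p) h
  refine MvPolynomial.ringHom_ext' (MonoidAlgebra.ringHom_ext (fun r => ?_) (fun g => ?_))
    (fun i => ?_)
  · simp [polynomialToLaurent, laurentHom_single]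
  · simp only [polynomialToLaurent, RingHom.comp_apply, MvPolynomial.coe_eval₂Hom,
      MvPolynomial.eval₂_C, MonoidAlgebra.mapDomainRingHom_apply, MonoidAlgebra.mapDomain_single,
      laurentHom_single, laurentMonomial_coeffExponents, RingHom.coe_coe, MvPolynomial.aeval_C,
      ← MonoidAlgebra.one_def, map_one, one_mul]
    rfl
  · simp only [polynomialToLaurent, RingHom.comp_apply, MvPolynomial.coe_eval₂Hom,
      MvPolynomial.eval₂_X, laurentHom_of, laurentMonomial_clusterExponents, RingHom.coe_coe,
      MvPolynomial.aeval_X]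
    rw [Finset.prod_eq_single i]
    · simp
    · intro k _ hk; simp [Pi.single_eq_of_ne hk]
    · simp

/-- Clearing the denominators of a Laurent polynomial. -/
theorem exists_of_mul_eq_polynomialToLaurent {K : Type*} [CommRing K] {m n : ℕ}
    (f : MonoidAlgebra K (Exponents m n)) :
    ∃ (e : Fin n → ℕ) (p : MvPolynomial (Fin n) (CoeffRing K m)),
      MonoidAlgebra.of K _ (clusterExponents m fun i => (e i : ℤ)) * f
        = polynomialToLaurent K m n p := by
  have hX : ∀ d : Fin n → ℕ, polynomialToLaurent K m n (∏ i, MvPolynomial.X i ^ d i) =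
      MonoidAlgebra.of K _ (clusterExponents m fun i => (d i : ℤ)) := by
    intro d
    simp only [polynomialToLaurent, map_prod, map_pow, MvPolynomial.coe_eval₂Hom,
      MvPolynomial.eval₂_X]
    simp only [← map_pow, ← map_prod]
    congr 1
    refine Multiplicative.toAdd.injective (funext fun r => ?_)
    rcases r with i | l
    · simp [clusterExponents, toAdd_prod, Pi.single_apply]
    · simp [clusterExponents, toAdd_prod]
  induction f using MonoidAlgebra.induction_linear with
  | zero => exact ⟨0, 0, by simp⟩
  | add f g hf hg =>
    obtain ⟨e, p, hp⟩ := hf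
    obtain ⟨d, q, hq⟩ := hg
    refine ⟨e + d, (∏ i, MvPolynomial.X i ^ d i) * p + (∏ i, MvPolynomial.X i ^ e i) * q, ?_⟩
    have : clusterExponents m (fun i => (((e + d) i : ℕ) : ℤ)) =
        clusterExponents m (fun i => (e i : ℤ)) * clusterExponents m fun i => (d i : ℤ) := by
      refine Multiplicative.toAdd.injective (funext fun r => ?_)
      rcases r with i | l <;> simp [clusterExponents]
    rw [map_add, map_mul, map_mul, hX, hX, ← hp, ← hq, this, map_mul]
    ring
  | single v r =>
    refine ⟨fun i => (-v.toAdd (.inl i)).toNat, MvPolynomial.C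
      (MonoidAlgebra.single (Multiplicative.ofAdd fun l => v.toAdd (.inr l)) r) *
        ∏ i, MvPolynomial.X i ^ (v.toAdd (.inl i)).toNat, ?_⟩
    rw [map_mul, hX]
    simp only [polynomialToLaurent, MvPolynomial.coe_eval₂Hom, MvPolynomial.eval₂_C,
      MonoidAlgebra.mapDomainRingHom_apply, MonoidAlgebra.mapDomain_single, MonoidAlgebra.of_apply,
      MonoidAlgebra.single_mul_single, one_mul, mul_one]
    congr 1
    refine Multiplicative.toAdd.injective (funext fun s => ?_)
    rcases s with i | l
    · simp [clusterExponents, coeffExponents]; omega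
    · simp [clusterExponents, coeffExponents]

theorem laurentHom_injective (hA : ∀ i, t.A i ≠ 0)
    (hind : AlgebraicIndependent (CoeffRing K m) t.A) : Function.Injective (t.laurentHom hA) := by
  rw [injective_iff_map_eq_zero]
  intro f hf
  obtain ⟨e, p, hp⟩ := exists_of_mul_eq_polynomialToLaurent f
  have h0 : MvPolynomial.aeval t.A p = 0 := by
    rw [← laurentHom_polynomialToLaurent t hA, ← hp, map_mul, hf, mul_zero]
  have hp0 : p = 0 := hind (by rw [h0, map_zero])
  rw [hp0, map_zero] at hp
  have hinv := congrArg (fun g => MonoidAlgebra.of K _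
    (clusterExponents m fun i => (e i : ℤ))⁻¹ * g) hp
  simpa only [← mul_assoc, ← map_mul, inv_mul_cancel, map_one, one_mul, mul_zero] using hinv

theorem mem_laurentRing_iff (hA : ∀ i, t.A i ≠ 0) {M : AmbientField K m n} :
    M ∈ t.laurentRing ↔ ∃ f, t.laurentHom hA f = M := by
  constructor
  · intro hM
    refine Algebra.adjoin_induction (p := fun M _ => ∃ f, t.laurentHom hA f = M)
      ?_ ?_ ?_ ?_ hM
    · have hi : ∀ (i : Fin n) (d : ℤ), t.laurentMonomial hA (clusterExponents m (Pi.single i d)) =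
          t.A i ^ d := by
        intro i d
        rw [laurentMonomial_clusterExponents, Finset.prod_eq_single i]
        · simp
        · intro k _ hk; simp [Pi.single_eq_of_ne hk]
        · simp
      rintro _ (⟨i, rfl⟩ | ⟨i, rfl⟩)
      · exact ⟨MonoidAlgebra.of K _ (clusterExponents m (Pi.single i 1)), by
          rw [laurentHom_of, hi, zpow_one]⟩
      · exact ⟨MonoidAlgebra.of K _ (clusterExponents m (Pi.single i (-1))), by
          rw [laurentHom_of, hi, zpow_neg_one]⟩
    · intro c
      exact ⟨polynomialToLaurent K m n (MvPolynomial.C c), by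
        rw [laurentHom_polynomialToLaurent, MvPolynomial.aeval_C]⟩
    · rintro _ _ _ _ ⟨f, rfl⟩ ⟨g, rfl⟩
      exact ⟨f + g, map_add _ _ _⟩
    · rintro _ _ _ _ ⟨f, rfl⟩ ⟨g, rfl⟩
      exact ⟨f * g, map_mul _ _ _⟩
  · rintro ⟨f, rfl⟩
    induction f using MonoidAlgebra.induction_linear with
    | zero => rw [map_zero]; exact Subalgebra.zero_mem _
    | add f g hf hg => rw [map_add]; exact Subalgebra.add_mem _ hf hg
    | single v r =>
      rw [laurentHom_single, laurentMonomial_apply]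
      exact Subalgebra.mul_mem _ (Subalgebra.algebraMap_mem _ _)
        ((unitIn_coeff _ _).mul (UnitIn.prod fun i _ => (t.unitIn_laurentRing i).zpow _)).1

end SeedData

end

/-! ### Skew-symmetrizable matrices and the mutation rule -/

section Matrices

variable {n : ℕ} {B : Matrix (Fin n) (Fin n) ℤ}

theorem skewSymmetrizable_iff : SkewSymmetrizable B ↔
    ∃ S : Fin n → ℤ, (∀ i, 0 < S i) ∧ ∀ i j, S j * B j i = -(S i * B i j) := by
  simp only [SkewSymmetrizable, ← Matrix.ext_iff, Matrix.transpose_apply, Matrix.diagonal_mul,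
    Matrix.neg_apply]

theorem SkewSymmetrizable.diag_eq_zero (h : SkewSymmetrizable B) (k : Fin n) : B k k = 0 := by
  obtain ⟨S, hS, h⟩ := skewSymmetrizable_iff.mp h
  have h1 := h k k
  have : S k * B k k = 0 := by linarith
  exact (mul_eq_zero.mp this).resolve_left (hS k).ne'

theorem SkewSymmetrizable.nonneg_iff (h : SkewSymmetrizable B) (j k : Fin n) :
    0 ≤ B j k ↔ B k j ≤ 0 := by
  obtain ⟨S, hS, h⟩ := skewSymmetrizable_iff.mp h
  rw [← mul_nonneg_iff_of_pos_left (hS j), h k j, neg_nonneg]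
  constructor
  · intro h'
    by_contra! hcon
    exact absurd (mul_pos (hS k) hcon) (not_lt.mpr h')
  · exact fun h' => mul_nonpos_of_nonneg_of_nonpos (hS k).le h'

theorem sign_mul_max (b c : ℤ) :
    Int.sign b * max (b * c) 0 = b * max c 0 + c * max (-b) 0 := by
  rcases lt_trichotomy b 0 with hb | rfl | hb
  · rw [Int.sign_eq_neg_one_of_neg hb, max_eq_left (by omega : (0 : ℤ) ≤ -b)]
    rcases le_total c 0 with hc | hc
    · rw [max_eq_left (mul_nonneg_of_nonpos_of_nonpos hb.le hc), max_eq_right hc]; ring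
    · rw [max_eq_right (mul_nonpos_of_nonpos_of_nonneg hb.le hc), max_eq_left hc]; ring
  · simp
  · rw [Int.sign_eq_one_of_pos hb, max_eq_right (by omega : -b ≤ 0)]
    rcases le_total c 0 with hc | hc
    · rw [max_eq_right (mul_nonpos_of_nonneg_of_nonpos hb.le hc), max_eq_right hc]; ring
    · rw [max_eq_left (mul_nonneg hb.le hc), max_eq_left hc]; ring

theorem mutateMatrix_left (B : Matrix (Fin n) (Fin n) ℤ) (k j : Fin n) :
    mutateMatrix B k k j = -B k j := by simp [mutateMatrix]

theorem mutateMatrix_right (B : Matrix (Fin n) (Fin n) ℤ) (k i : Fin n) :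
    mutateMatrix B k i k = -B i k := by simp [mutateMatrix]

theorem mutateMatrix_of_ne (B : Matrix (Fin n) (Fin n) ℤ) {i j k : Fin n} (hi : i ≠ k)
    (hj : j ≠ k) :
    mutateMatrix B k i j = B i j + (B i k * max (B k j) 0 + B k j * max (-B i k) 0) := by
  simp [mutateMatrix, hi, hj, sign_mul_max]

theorem SkewSymmetrizable.mutateMatrix (h : SkewSymmetrizable B) (k : Fin n) :
    SkewSymmetrizable (mutateMatrix B k) := by
  obtain ⟨S, hS, h⟩ := skewSymmetrizable_iff.mp h
  refine skewSymmetrizable_iff.mpr ⟨S, hS, fun i j => ?_⟩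
  by_cases hi : i = k
  · subst hi; rw [mutateMatrix_left, mutateMatrix_right, mul_neg, h i j, mul_neg]
  by_cases hj : j = k
  · subst hj; rw [mutateMatrix_left, mutateMatrix_right, mul_neg, h i j, mul_neg]
  rw [mutateMatrix_of_ne _ hi hj, mutateMatrix_of_ne _ hj hi]
  have hmax : ∀ i, S k * max (B k i) 0 = S i * max (-B i k) 0 := by
    intro i
    rw [mul_max_of_nonneg _ _ (hS k).le, mul_max_of_nonneg _ _ (hS i).le, h i k]
    simp
  apply mul_left_cancel₀ (hS k).ne'
  linear_combination S k * h i j + S j * B j k * hmax i + S i * B i k * hmax j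
    + S j * max (-B j k) 0 * h i k + S i * max (-B i k) 0 * h k j

end Matrices

noncomputable section

variable {K : Type*} [CommRing K] [IsDomain K] {m n : ℕ}

theorem Trop.exponent_mul (x y : Trop m) (l : Fin m) :
    (x * y).exponent l = x.exponent l + y.exponent l := rfl

theorem Trop.exponent_inv (x : Trop m) (l : Fin m) : (x⁻¹).exponent l = -x.exponent l := rfl

theorem Trop.exponent_zpow (x : Trop m) (e : ℤ) (l : Fin m) :
    (x ^ e).exponent l = e * x.exponent l := by
  simp [Trop.exponent]

theorem Trop.exponent_one_oplus (x : Trop m) (l : Fin m) :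
    (Trop.oplus 1 x).exponent l = -max (-x.exponent l) 0 := by
  have : (Trop.oplus 1 x).exponent l = min 0 (x.exponent l) := rfl
  rw [this]; omega

theorem Trop.ext_exponent {x y : Trop m} (h : ∀ l, x.exponent l = y.exponent l) : x = y :=
  Multiplicative.toAdd.injective (funext h)

namespace SeedData

/-! ### Mutation of the extended exchange matrix -/

variable (t : SeedData K m n)

theorem extendedMatrix_inl {K : Type*} [CommRing K] {m n : ℕ} (t : SeedData K m n)
    (i j : Fin n) : t.extendedMatrix (.inl i) j = t.B i j := rfl

theorem extendedMatrix_inr {K : Type*} [CommRing K] {m n : ℕ} (t : SeedData K m n)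
    (l : Fin m) (j : Fin n) :
    t.extendedMatrix (.inr l) j = (t.X j).exponent l := rfl

theorem extendedMatrix_mutate_left (k j : Fin n) :
    (t.mutate k).extendedMatrix (.inl k) j = -t.B k j := mutateMatrix_left _ _ _

theorem extendedMatrix_mutate_right (k : Fin n) (r : Fin n ⊕ Fin m) :
    (t.mutate k).extendedMatrix r k = -t.extendedMatrix r k := by
  rcases r with i | l
  · exact mutateMatrix_right _ _ _
  · simp [extendedMatrix_inr, mutate, Trop.exponent_inv]

/-- The mutation rule of the tropical coefficients is the rule for exchange matrices, applied to
the rows of `C`. -/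
theorem extendedMatrix_mutate_of_ne {k j : Fin n} (hj : j ≠ k) {r : Fin n ⊕ Fin m}
    (hr : r ≠ .inl k) :
    (t.mutate k).extendedMatrix r j = t.extendedMatrix r j +
      (t.extendedMatrix r k * max (t.B k j) 0 + t.B k j * max (-t.extendedMatrix r k) 0) := by
  rcases r with i | l
  · exact mutateMatrix_of_ne _ (fun h => hr (by rw [h])) hj
  · simp only [extendedMatrix_inr, mutate, if_neg hj, Trop.exponent_mul, Trop.exponent_zpow,
      Trop.exponent_one_oplus]
    ring

/-- Mutation preserves the full rank property, stated as triviality of the kernel: mutation at `k`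
is a linear substitution in the `k`-th coordinate of the kernel vectors. -/
theorem eq_zero_of_mutate_mulVec_eq_zero {t : SeedData K m n} (hB : SkewSymmetrizable t.B)
    (ht : ∀ v, t.extendedMatrix.mulVec v = 0 → v = 0) (k : Fin n) {v : Fin n → ℤ}
    (hv : (t.mutate k).extendedMatrix.mulVec v = 0) : v = 0 := by
  have hkk := hB.diag_eq_zero k
  have hrow : ∀ r, ∑ j, (t.mutate k).extendedMatrix r j * v j = 0 := fun r => congrFun hv r
  have hk : ∑ j, t.B k j * v j = 0 := by
    have := hrow (.inl k)
    simp only [extendedMatrix_mutate_left, neg_mul, Finset.sum_neg_distrib] at this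
    omega
  set a := ∑ j, max (t.B k j) 0 * v j with ha
  have hw := ht (Function.update v k (a - v k)) (funext fun r => ?_)
  · have hne : ∀ j ≠ k, v j = 0 := fun j hj => by
      have := congrFun hw j
      rwa [Function.update_of_ne hj] at this
    have ha0 : a = 0 := Finset.sum_eq_zero fun j _ => by
      by_cases hj : j = k
      · subst hj; simp [hkk]
      · rw [hne j hj, mul_zero]
    funext j
    by_cases hj : j = k
    · subst hj
      have := congrFun hw j
      rw [Function.update_self, ha0] at this
      simpa using this
    · exact hne j hj
  · have hupd : ∑ j, t.extendedMatrix r j * Function.update v k (a - v k) j =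
        ∑ j, t.extendedMatrix r j * v j + t.extendedMatrix r k * (a - 2 * v k) := by
      rw [Finset.sum_eq_add_sum_sdiff_singleton_of_mem (Finset.mem_univ k),
        Finset.sum_eq_add_sum_sdiff_singleton_of_mem (Finset.mem_univ k)
          (fun j => t.extendedMatrix r j * v j), Function.update_self]
      have : ∀ j ∈ Finset.univ \ {k}, t.extendedMatrix r j * Function.update v k (a - v k) j =
          t.extendedMatrix r j * v j := fun j hj => by
        rw [Function.update_of_ne (by simpa using hj)]
      rw [Finset.sum_congr rfl this]
      ring
    change ∑ j, t.extendedMatrix r j * Function.update v k (a - v k) j = 0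
    rw [hupd]
    by_cases hr : r = .inl k
    · subst hr
      simp only [extendedMatrix_inl, hk, hkk, zero_mul, add_zero]
    · have h := hrow r
      have hterm : ∀ j, (t.mutate k).extendedMatrix r j * v j =
          t.extendedMatrix r j * v j + t.extendedMatrix r k * (max (t.B k j) 0 * v j)
            + max (-t.extendedMatrix r k) 0 * (t.B k j * v j)
            + (if j = k then -2 * t.extendedMatrix r k * v k else 0) := by
        intro j
        by_cases hj : j = k
        · subst hj; rw [extendedMatrix_mutate_right, if_pos rfl, hkk]; simp; ring
        · rw [extendedMatrix_mutate_of_ne _ hj hr, if_neg hj]; ring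
      simp only [hterm, Finset.sum_add_distrib, ← Finset.mul_sum, hk, ← ha] at h
      simp only [Finset.sum_ite_eq', Finset.mem_univ, if_true] at h
      linear_combination h

/-! ### Exchange binomials and the variables `ŷ` -/

/-- `ŷ_j = X_j ∏ A_i ^ b_ij`, the ratio of the two terms of the `j`-th exchange binomial. -/
def yhat (j : Fin n) : AmbientField K m n := coeff K n (t.X j) * ∏ i, t.A i ^ t.B i j

/-- The monomial `1 / (1 ⊕ X_k) * ∏ A_i ^ max (-b_ik, 0)`, the second term of the `k`-th exchange
binomial. -/
def secondTerm (k : Fin n) : AmbientField K m n :=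
  coeff K n (1 / Trop.oplus 1 (t.X k)) * ∏ j, t.A j ^ (-(t.B j k)).toNat

variable {t}

theorem secondTerm_ne_zero (hA : ∀ i, t.A i ≠ 0) (k : Fin n) : t.secondTerm k ≠ 0 :=
  mul_ne_zero (coeff_ne_zero _) (Finset.prod_ne_zero_iff.mpr fun i _ => pow_ne_zero _ (hA i))

theorem yhat_ne_zero (hA : ∀ i, t.A i ≠ 0) (k : Fin n) : t.yhat k ≠ 0 :=
  mul_ne_zero (coeff_ne_zero _) (Finset.prod_ne_zero_iff.mpr fun i _ => zpow_ne_zero _ (hA i))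

theorem exchangeBinomial_eq (hA : ∀ i, t.A i ≠ 0) (k : Fin n) :
    t.exchangeBinomial k = t.secondTerm k * (1 + t.yhat k) := by
  have h1 : coeff K n (t.X k / Trop.oplus 1 (t.X k)) =
      coeff K n (1 / Trop.oplus 1 (t.X k)) * coeff K n (t.X k) := by
    rw [← coeff_mul, div_mul_eq_mul_div, one_mul]
  have h2 : ∏ j, t.A j ^ (t.B j k).toNat =
      (∏ j, t.A j ^ (-(t.B j k)).toNat) * ∏ j, t.A j ^ t.B j k := by
    rw [← Finset.prod_mul_distrib]
    refine Finset.prod_congr rfl fun j _ => ?_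
    rw [← zpow_natCast, ← zpow_natCast, ← zpow_add₀ (hA j)]
    congr 1
    omega
  rw [exchangeBinomial, secondTerm, yhat, h1, h2]
  ring

theorem mutate_A_self (k : Fin n) : (t.mutate k).A k = (t.A k)⁻¹ * t.exchangeBinomial k :=
  if_pos rfl

theorem mutate_A_of_ne {i k : Fin n} (h : i ≠ k) : (t.mutate k).A i = t.A i := if_neg h

/-- The mutation rule `ŷ_j ↦ ŷ_j ŷ_k ^ max (b_kj, 0) (1 + ŷ_k) ^ (-b_kj)`. -/
theorem yhat_mutate (hA : ∀ i, t.A i ≠ 0) (hB : SkewSymmetrizable t.B) {j k : Fin n} (hj : j ≠ k)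
    (hP : 1 + t.yhat k ≠ 0) :
    (t.mutate k).yhat j =
      t.yhat j * t.yhat k ^ max (t.B k j) 0 * (1 + t.yhat k) ^ (-t.B k j) := by
  have hkk := hB.diag_eq_zero k
  have hA0 : ∀ e : Fin n → ℤ, ∏ i, t.A i ^ e i ≠ 0 := fun e =>
    Finset.prod_ne_zero_iff.mpr fun i _ => zpow_ne_zero _ (hA i)
  -- The new cluster variable enters with exponent `-b_kj`; everything else is a monomial.
  have hprod : ∏ i, (t.mutate k).A i ^ (t.mutate k).B i j =
      (∏ i, t.A i ^ t.B i j) * (∏ i, t.A i ^ t.B i k) ^ max (t.B k j) 0 *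
        (∏ i, t.A i ^ max (-t.B i k) 0) ^ (t.B k j) * (t.exchangeBinomial k) ^ (-t.B k j) := by
    have hterm : ∀ i, (t.mutate k).A i ^ (t.mutate k).B i j =
        t.A i ^ t.B i j * (t.A i ^ t.B i k) ^ max (t.B k j) 0 *
          (t.A i ^ max (-t.B i k) 0) ^ (t.B k j) *
            (if i = k then (t.exchangeBinomial k) ^ (-t.B k j) else 1) := by
      intro i
      by_cases hi : i = k
      · subst hi
        rw [if_pos rfl, mutate_A_self, show (t.mutate i).B i j = -t.B i j from
          mutateMatrix_left _ _ _, mul_zpow, inv_zpow', neg_neg, hkk]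
        simp
      · rw [if_neg hi, mutate_A_of_ne hi, show (t.mutate k).B i j = _ from
          mutateMatrix_of_ne _ hi hj, zpow_add₀ (hA i), zpow_add₀ (hA i), zpow_mul, mul_one,
          mul_comm (t.B k j), zpow_mul]
        ring
    simp only [hterm, Finset.prod_mul_distrib, Finset.prod_zpow, Finset.prod_ite_eq',
      Finset.mem_univ, if_true]
  have hsec : t.secondTerm k = (coeff K n (Trop.oplus 1 (t.X k)))⁻¹ *
      ∏ i, t.A i ^ max (-t.B i k) 0 := by
    rw [secondTerm, one_div, coeff_inv]
    congr 1
    refine Finset.prod_congr rfl fun i _ => ?_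
    rw [← zpow_natCast, Int.ofNat_toNat]
  rw [yhat, hprod, exchangeBinomial_eq hA, hsec]
  rw [show (t.mutate k).X j = t.X j * t.X k ^ max (t.B k j) 0 *
    Trop.oplus 1 (t.X k) ^ (-(t.B k j)) from if_neg hj]
  have hc := coeff_ne_zero (K := K) (n := n) (Trop.oplus 1 (t.X k))
  have hm := hA0 fun i => max (-t.B i k) 0
  simp only [coeff_mul, coeff_inv, coeff_zpow, yhat, mul_zpow, inv_zpow', zpow_neg]
  field_simp

/-- The columns of the extended exchange matrix as exponent vectors of Laurent monomials. -/
def columnExponents (t : SeedData K m n) (j : Fin n) : Exponents m n :=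
  Multiplicative.ofAdd fun r => t.extendedMatrix r j

theorem yhat_eq (hA : ∀ i, t.A i ≠ 0) (j : Fin n) :
    t.yhat j = t.laurentHom hA (MonoidAlgebra.of K _ (t.columnExponents j)) := by
  rw [laurentHom_of, laurentMonomial_apply]
  rfl

theorem one_add_laurentMonomial_ne_zero (hind : AlgebraicIndependent (CoeffRing K m) t.A)
    (hA : ∀ i, t.A i ≠ 0) {v : Exponents m n} (hv : v ≠ 1) :
    1 + t.laurentHom hA (MonoidAlgebra.of K _ v) ≠ 0 := by
  rw [← map_one (t.laurentHom hA), ← map_add, map_ne_zero_iff _ (t.laurentHom_injective hA hind)]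
  intro h
  have := congrArg (fun f => f.coeff 1) h
  simp [MonoidAlgebra.one_def, hv.symm] at this

/-! ### Seeds of full rank -/

/-- The properties of a seed of full rank that are used below and that mutation preserves. Full rank
is stated as triviality of the kernel of the extended exchange matrix over `ℤ`. -/
structure IsFullRankSeed (t : SeedData K m n) : Prop where
  skewSymmetrizable : SkewSymmetrizable t.B
  algebraicIndependent : AlgebraicIndependent (CoeffRing K m) t.A
  eq_zero_of_mulVec : ∀ v, t.extendedMatrix.mulVec v = 0 → v = 0

theorem IsSeed.isFullRankSeed {s : SeedData K m n} (hs : s.IsSeed) (hr : s.FullRank) :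
    s.IsFullRankSeed where
  skewSymmetrizable := hs.skewSymmetrizable
  algebraicIndependent := hs.algebraicIndependent
  eq_zero_of_mulVec := by
    intro v hv
    set E := s.extendedMatrix.map (Int.cast : ℤ → ℚ) with hE
    have hinj : Function.Injective E.mulVec := by
      rw [Matrix.mulVec_injective_iff, linearIndependent_iff_card_eq_finrank_span,
        Fintype.card_fin, Set.finrank, ← Matrix.rank_eq_finrank_span_cols]
      exact hr.symm
    have h0 : E.mulVec (fun j => (v j : ℚ)) = 0 := by
      funext r
      have := congrFun hv r
      simp only [Matrix.mulVec, dotProduct, Pi.zero_apply] at this ⊢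
      simp only [hE, Matrix.map_apply]
      exact_mod_cast this
    have := hinj (h0.trans (Matrix.mulVec_zero E).symm)
    funext j
    have := congrFun this j
    simpa using this

theorem exchangeBinomial_mem {t : SeedData K m n} (hB : SkewSymmetrizable t.B) (k : Fin n)
    {T : Subalgebra (CoeffRing K m) (AmbientField K m n)} (h : ∀ i ≠ k, t.A i ∈ T) :
    t.exchangeBinomial k ∈ T := by
  have hprod : ∀ e : Fin n → ℕ, e k = 0 → ∏ j, t.A j ^ e j ∈ T := by
    intro e he
    refine Subalgebra.prod_mem _ fun j _ => ?_
    by_cases hj : j = k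
    · subst hj; rw [he, pow_zero]; exact T.one_mem
    · exact T.pow_mem (h j hj) _
  have hkk := hB.diag_eq_zero k
  exact T.add_mem (T.mul_mem (T.algebraMap_mem _) (hprod _ (by simp [hkk])))
    (T.mul_mem (T.algebraMap_mem _) (hprod _ (by simp [hkk])))

namespace IsFullRankSeed

theorem columnExponents_ne_one {K : Type*} [CommRing K] {m n : ℕ}
    {t : SeedData K m n} (ht : t.IsFullRankSeed) (k : Fin n) : t.columnExponents k ≠ 1 := by
  intro h
  have := ht.eq_zero_of_mulVec (Pi.single k 1) (by
    rw [Matrix.mulVec_single_one]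
    exact congrArg Multiplicative.toAdd h)
  simpa using congrFun this k

/-- For `j ≠ k` some grading of the Laurent monomials has degree zero on the `j`-th and nonzero
degree on the `k`-th column of the extended exchange matrix: if every `2 × 2` minor of the two
columns vanished, they would be linearly dependent. -/
theorem exists_grading {K : Type*} [CommRing K] {m n : ℕ}
    {t : SeedData K m n} (ht : t.IsFullRankSeed) {j k : Fin n} (hjk : j ≠ k) :
    ∃ l : Exponents m n →* Multiplicative ℤ,
      l (t.columnExponents j) = 1 ∧ l (t.columnExponents k) ≠ 1 := by
  obtain ⟨r, r', h⟩ : ∃ r r', t.extendedMatrix r k * t.extendedMatrix r' j -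
      t.extendedMatrix r' k * t.extendedMatrix r j ≠ 0 := by
    by_contra! hcon
    obtain ⟨r', hr'⟩ : ∃ r', t.extendedMatrix r' j ≠ 0 := by
      by_contra! h0
      exact ht.columnExponents_ne_one j (Multiplicative.toAdd.injective (funext h0))
    have := ht.eq_zero_of_mulVec
      (Pi.single k (t.extendedMatrix r' j) - Pi.single j (t.extendedMatrix r' k)) (by
        funext r
        rw [Matrix.mulVec_sub, Pi.sub_apply, Matrix.mulVec_single, Matrix.mulVec_single]
        simpa [mul_comm] using hcon r r')
    have := congrFun this k
    rw [Pi.sub_apply, Pi.single_eq_same, Pi.single_eq_of_ne hjk.symm] at this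
    exact hr' (by simpa using this)
  refine ⟨{ toFun := fun v => Multiplicative.ofAdd
              (v.toAdd r * t.extendedMatrix r' j - v.toAdd r' * t.extendedMatrix r j)
            map_one' := by simp
            map_mul' := fun v w => by
              rw [← ofAdd_add]; congr 1; simp only [toAdd_mul, Pi.add_apply]; ring }, ?_, ?_⟩
  · exact congrArg Multiplicative.ofAdd (sub_eq_zero.mpr (mul_comm _ _))
  · intro h0
    exact h (congrArg Multiplicative.toAdd h0)

variable (ht : t.IsFullRankSeed)
include ht

theorem ne_zero (i : Fin n) : t.A i ≠ 0 := by
  intro h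
  have := ht.algebraicIndependent.transcendental i
  rw [h] at this
  exact this isAlgebraic_zero

theorem one_add_yhat_ne_zero (k : Fin n) : 1 + t.yhat k ≠ 0 := by
  rw [yhat_eq ht.ne_zero]
  exact one_add_laurentMonomial_ne_zero ht.algebraicIndependent _ (ht.columnExponents_ne_one k)

theorem exchangeBinomial_ne_zero (k : Fin n) : t.exchangeBinomial k ≠ 0 := by
  rw [exchangeBinomial_eq ht.ne_zero]
  exact mul_ne_zero (secondTerm_ne_zero ht.ne_zero k) (ht.one_add_yhat_ne_zero k)

theorem mutate (k : Fin n) : (t.mutate k).IsFullRankSeed where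
  skewSymmetrizable := ht.skewSymmetrizable.mutateMatrix k
  algebraicIndependent := algebraicIndependent_exchange ht.algebraicIndependent k
    (exchangeBinomial_mem ht.skewSymmetrizable k fun i hi => Algebra.subset_adjoin ⟨i, hi, rfl⟩)
    (ht.exchangeBinomial_ne_zero k) (mutate_A_self k) (fun _ hi => mutate_A_of_ne hi)
  eq_zero_of_mulVec := fun _ hv =>
    eq_zero_of_mutate_mulVec_eq_zero ht.skewSymmetrizable ht.eq_zero_of_mulVec k hv

theorem of_isSeedOf {t' : SeedData K m n} (h : t.IsSeedOf t') : t'.IsFullRankSeed := by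
  induction h with
  | refl => exact ht
  | tail _ h ih =>
    obtain ⟨k, rfl⟩ := h
    exact ih.mutate k

theorem mutate_mutate (k : Fin n) : (t.mutate k).mutate k = t := by
  have hkk := ht.skewSymmetrizable.diag_eq_zero k
  have hP := ht.exchangeBinomial_ne_zero k
  have hAk := ht.ne_zero k
  have hext : ((t.mutate k).mutate k).extendedMatrix = t.extendedMatrix := by
    ext r j
    by_cases hr : r = .inl k
    · subst hr
      rw [extendedMatrix_mutate_left, show (t.mutate k).B k j = -t.B k j from
        mutateMatrix_left _ _ _, neg_neg, extendedMatrix_inl]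
    by_cases hj : j = k
    · subst hj; rw [extendedMatrix_mutate_right, extendedMatrix_mutate_right, neg_neg]
    rw [extendedMatrix_mutate_of_ne _ hj hr, extendedMatrix_mutate_of_ne _ hj hr,
      extendedMatrix_mutate_right, show (t.mutate k).B k j = -t.B k j from
        mutateMatrix_left _ _ _, neg_neg]
    have h : ∀ x : ℤ, max x 0 = x + max (-x) 0 := fun x => by omega
    rw [h (t.B k j), h (t.extendedMatrix r k)]
    ring
  have hbin : (t.mutate k).exchangeBinomial k = t.exchangeBinomial k := by
    have hprod : ∀ e : Fin n → ℕ, e k = 0 →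
        ∏ j, (t.mutate k).A j ^ e j = ∏ j, t.A j ^ e j := by
      intro e he
      refine Finset.prod_congr rfl fun j _ => ?_
      by_cases hj : j = k
      · subst hj; rw [he, pow_zero, pow_zero]
      · rw [mutate_A_of_ne hj]
    have hB : ∀ j, (t.mutate k).B j k = -t.B j k := fun j => mutateMatrix_right _ _ _
    have hX : (t.mutate k).X k = (t.X k)⁻¹ := if_pos rfl
    have hX1 : (t.X k)⁻¹ / Trop.oplus 1 (t.X k)⁻¹ = 1 / Trop.oplus 1 (t.X k) := by
      refine Trop.ext_exponent fun l => ?_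
      simp only [div_eq_mul_inv, one_mul, Trop.exponent_mul, Trop.exponent_inv,
        Trop.exponent_one_oplus]
      omega
    have hX2 : 1 / Trop.oplus 1 (t.X k)⁻¹ = t.X k / Trop.oplus 1 (t.X k) := by
      refine Trop.ext_exponent fun l => ?_
      simp only [div_eq_mul_inv, one_mul, Trop.exponent_mul, Trop.exponent_inv,
        Trop.exponent_one_oplus]
      omega
    simp only [exchangeBinomial, hB, hX, hX1, hX2, neg_neg]
    rw [hprod _ (by simp [hkk]), hprod _ (by simp [hkk]), add_comm]
  have hB' : ((t.mutate k).mutate k).B = t.B := by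
    ext i j; exact congrFun (congrFun hext (.inl i)) j
  have hX' : ((t.mutate k).mutate k).X = t.X := by
    funext j
    exact Trop.ext_exponent fun l => congrFun (congrFun hext (.inr l)) j
  have hA' : ((t.mutate k).mutate k).A = t.A := by
    funext i
    by_cases hi : i = k
    · subst hi
      rw [mutate_A_self, mutate_A_self, hbin]
      field_simp
    · rw [mutate_A_of_ne hi, mutate_A_of_ne hi]
  generalize (t.mutate k).mutate k = u at hB' hX' hA'
  cases u; cases t
  simp_all

end IsFullRankSeed

/-! ### The upper bound of a seed and its invariance under mutation -/

/-- `𝓛(t) ∩ 𝓛(μ_j t)` is generated by `A_j`, the new variable of `μ_j t`, and the `A_i ^ {±1}` with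
`i ≠ j`. -/
theorem IsFullRankSeed.mem_of_mem_laurentRing_of_mem_laurentRing_mutate (ht : t.IsFullRankSeed)
    (j : Fin n) {M : AmbientField K m n} (h₁ : M ∈ t.laurentRing)
    (h₂ : M ∈ (t.mutate j).laurentRing) {S : Subalgebra (CoeffRing K m) (AmbientField K m n)}
    (hS : ∀ i ≠ j, UnitIn S (t.A i)) (hSj : t.A j ∈ S) (hSj' : (t.mutate j).A j ∈ S) : M ∈ S :=
  mem_of_mem_laurent_exchange ht.algebraicIndependent j
    (exchangeBinomial_mem ht.skewSymmetrizable j fun _ hi => (unitIn_laurentWithout _ hi).1)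
    (ht.exchangeBinomial_ne_zero j) (mutate_A_self j) (fun _ hi => mutate_A_of_ne hi) h₁ h₂ hS hSj
    hSj'

/-- Coprimality of binomials in a Laurent ring, from a grading that separates them. -/
theorem IsFullRankSeed.mul_inv_mem_laurentRing (ht : t.IsFullRankSeed) {a b : Exponents m n}
    (l : Exponents m n →* Multiplicative ℤ) (hb : l b = 1) (ha : l a ≠ 1) (hb1 : b ≠ 1)
    {f : AmbientField K m n} (hf : f ∈ t.laurentRing)
    (h : (1 + t.laurentMonomial ht.ne_zero a) * f * (1 + t.laurentMonomial ht.ne_zero b)⁻¹ ∈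
      t.laurentRing) :
    f * (1 + t.laurentMonomial ht.ne_zero b)⁻¹ ∈ t.laurentRing := by
  obtain ⟨f, rfl⟩ := (mem_laurentRing_iff t ht.ne_zero).mp hf
  obtain ⟨g, hg⟩ := (mem_laurentRing_iff t ht.ne_zero).mp h
  have hb0 := one_add_laurentMonomial_ne_zero ht.algebraicIndependent ht.ne_zero hb1
  have hdvd : 1 + MonoidAlgebra.of K _ b ∣ (1 + MonoidAlgebra.of K _ a) * f := by
    refine ⟨g, t.laurentHom_injective ht.ne_zero ht.algebraicIndependent ?_⟩
    rw [laurentHom_of] at hb0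
    rw [map_mul, map_mul, hg, map_add, map_add, map_one, laurentHom_of, laurentHom_of]
    field_simp
  obtain ⟨f', rfl⟩ := one_add_of_dvd_of_dvd_mul l hb ha hdvd
  refine (mem_laurentRing_iff t ht.ne_zero).mpr ⟨f', ?_⟩
  rw [laurentHom_of] at hb0
  rw [map_mul, map_add, map_one, laurentHom_of]
  field_simp

theorem unitIn_secondTerm (hB : SkewSymmetrizable t.B) (k : Fin n)
    {T : Subalgebra (CoeffRing K m) (AmbientField K m n)} (h : ∀ i ≠ k, UnitIn T (t.A i)) :
    UnitIn T (t.secondTerm k) := by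
  refine (unitIn_coeff _ _).mul ?_
  simp only [← zpow_natCast]
  refine unitIn_prod_zpow fun i hi => h i ?_
  rintro rfl
  simp [hB.diag_eq_zero i] at hi

theorem unitIn_yhat (hB : SkewSymmetrizable t.B) (k : Fin n)
    {T : Subalgebra (CoeffRing K m) (AmbientField K m n)} (h : ∀ i ≠ k, UnitIn T (t.A i)) :
    UnitIn T (t.yhat k) := by
  refine (unitIn_coeff _ _).mul (unitIn_prod_zpow fun i hi => h i ?_)
  rintro rfl
  exact hi (hB.diag_eq_zero i)

theorem unitIn_laurentRing_mutate_mutate {i j k : Fin n} (hi : i ≠ j) :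
    UnitIn ((t.mutate k).mutate j).laurentRing ((t.mutate k).A i) := by
  rw [← mutate_A_of_ne (t := t.mutate k) hi]
  exact unitIn_laurentRing _ i

section Exchange

variable {j k : Fin n} (ht : t.IsFullRankSeed) (hjk : j ≠ k)
include ht hjk

/-- `A_j` is, up to a unit of `𝓛(μ_j μ_k t)`, the binomial `1 + ŷ_j` of `μ_k t`. -/
theorem IsFullRankSeed.exists_unit_mul_eq :
    ∃ w, UnitIn ((t.mutate k).mutate j).laurentRing w ∧ w ≠ 0 ∧
      t.A j = w * (1 + (t.mutate k).yhat j) := by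
  have ht₁ := ht.mutate k
  have hunit := fun i (hi : i ≠ j) => unitIn_laurentRing_mutate_mutate (t := t) (k := k) hi
  have h0 := secondTerm_ne_zero ht₁.ne_zero j
  have h1 := (ht₁.mutate j).ne_zero j
  refine ⟨(((t.mutate k).mutate j).A j)⁻¹ * (t.mutate k).secondTerm j,
    (unitIn_laurentRing _ j).inv.mul (unitIn_secondTerm ht₁.skewSymmetrizable j hunit),
    mul_ne_zero (inv_ne_zero h1) h0, ?_⟩
  have h2 := ht₁.one_add_yhat_ne_zero j
  have h3 := ht.ne_zero j
  rw [mutate_A_self, exchangeBinomial_eq ht₁.ne_zero, mutate_A_of_ne hjk]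
  field_simp

/-- The common part of the three cases `b_kj < 0`, `b_kj = 0`, `b_kj > 0` of the exchange step. The
element `p` is the `k`-th exchange binomial of `t` up to a unit of `T = 𝓛(μ_j μ_k t)`. An element
`M` of `𝓛(t) ∩ 𝓛(μ_k t) ∩ 𝓛(μ_j t)` lies in `T[1/p]` and in `T[1/A_j]`, hence in `T`. -/
theorem IsFullRankSeed.mem_laurentRing_of_coprime {p σ : AmbientField K m n} {e : ℤ}
    (hp : p ∈ ((t.mutate k).mutate j).laurentRing) (hp0 : p ≠ 0)
    (hσ : UnitIn ((t.mutate k).mutate j).laurentRing σ)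
    (hσp : t.exchangeBinomial k = σ * p)
    (hy : t.yhat j = (t.mutate k).yhat j * p ^ e)
    (he : e = 0 ∨ (p - 1) * (t.A j)⁻¹ ∈ ((t.mutate k).mutate j).laurentRing)
    (hcop : ∀ f ∈ ((t.mutate k).mutate j).laurentRing,
      p * f * (t.A j)⁻¹ ∈ ((t.mutate k).mutate j).laurentRing →
        f * (t.A j)⁻¹ ∈ ((t.mutate k).mutate j).laurentRing)
    {M : AmbientField K m n} (h₀ : M ∈ t.laurentRing) (h₁ : M ∈ (t.mutate k).laurentRing)
    (h₂ : M ∈ (t.mutate j).laurentRing) : M ∈ ((t.mutate k).mutate j).laurentRing := by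
  have ht₁ := ht.mutate k
  have hunit := fun i (hi : i ≠ j) => unitIn_laurentRing_mutate_mutate (t := t) (k := k) hi
  obtain ⟨w, hw, hw0, hjw⟩ := ht.exists_unit_mul_eq hjk
  set T := ((t.mutate k).mutate j).laurentRing with hT
  set v := (t.mutate k).yhat j with hv
  have hvT : UnitIn T v := unitIn_yhat ht₁.skewSymmetrizable j hunit
  have hv0 : 1 + v ≠ 0 := ht₁.one_add_yhat_ne_zero j
  have hyT : t.A j ∈ T := by
    rw [hjw]; exact T.mul_mem hw.1 (T.add_mem T.one_mem hvT.1)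
  have hvy : (1 + v) * (t.A j)⁻¹ ∈ T := by
    have : (1 + v) * (t.A j)⁻¹ = w⁻¹ := by rw [hjw]; field_simp
    rw [this]; exact hw.2
  have hMy : M ∈ away T (t.A j) hyT := by
    refine laurentRing_le (fun i => ?_) h₁
    by_cases hi : i = j
    · subst hi
      rw [mutate_A_of_ne hjk]
      exact unitIn_away hyT (ht.ne_zero i)
    · exact (hunit i hi).mono (le_away hyT)
  have hpunit := unitIn_away hp hp0
  have hAunit : ∀ i ≠ j, UnitIn (away T p hp) (t.A i) := by
    intro i hi
    by_cases hik : i = k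
    · subst hik
      have : t.A i = σ * p * ((t.mutate i).A i)⁻¹ := by
        have hP := ht.exchangeBinomial_ne_zero i
        have hAi := ht.ne_zero i
        rw [mutate_A_self, ← hσp]; field_simp
      rw [this]
      exact ((hσ.mono (le_away hp)).mul hpunit).mul ((hunit i hi).mono (le_away hp)).inv
    · have := hunit i hi
      rw [mutate_A_of_ne hik] at this
      exact this.mono (le_away hp)
  have hMp : M ∈ away T p hp := by
    refine ht.mem_of_mem_laurentRing_of_mem_laurentRing_mutate j h₀ h₂ hAunit
      (le_away hp hyT) ?_
    rw [mutate_A_self, exchangeBinomial_eq ht.ne_zero]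
    have hsplit : (t.A j)⁻¹ * (t.secondTerm j * (1 + t.yhat j)) = t.secondTerm j *
        ((1 + v) * (t.A j)⁻¹ + v * ((p ^ e - 1) * (t.A j)⁻¹)) := by
      rw [hy]; ring
    rw [hsplit]
    refine Subalgebra.mul_mem _ (unitIn_secondTerm ht.skewSymmetrizable j hAunit).1
      (Subalgebra.add_mem _ (le_away hp hvy) (Subalgebra.mul_mem _ (le_away hp hvT.1) ?_))
    rcases he with rfl | he
    · simp
    · exact zpow_sub_one_mul_mem hpunit hp0 (le_away hp he) e
  exact mem_of_mem_away_of_mem_away hp hyT (ht.ne_zero j) hcop hMp hMy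

/-- The case `p ≡ 1` modulo `A_j`, which covers `b_kj ≠ 0`. -/
theorem IsFullRankSeed.mem_laurentRing_of_sub_one_mul_mem {p σ : AmbientField K m n} {e : ℤ}
    (hp : (p - 1) * (t.A j)⁻¹ ∈ ((t.mutate k).mutate j).laurentRing) (hp0 : p ≠ 0)
    (hσ : UnitIn ((t.mutate k).mutate j).laurentRing σ)
    (hσp : t.exchangeBinomial k = σ * p)
    (hy : t.yhat j = (t.mutate k).yhat j * p ^ e)
    {M : AmbientField K m n} (h₀ : M ∈ t.laurentRing) (h₁ : M ∈ (t.mutate k).laurentRing)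
    (h₂ : M ∈ (t.mutate j).laurentRing) : M ∈ ((t.mutate k).mutate j).laurentRing := by
  have ht₁ := ht.mutate k
  obtain ⟨w, hw, -, hjw⟩ := ht.exists_unit_mul_eq hjk
  have hj0 := ht.ne_zero j
  have hyT : t.A j ∈ ((t.mutate k).mutate j).laurentRing := by
    rw [hjw]
    exact Subalgebra.mul_mem _ hw.1 (Subalgebra.add_mem _ (Subalgebra.one_mem _)
      (unitIn_yhat ht₁.skewSymmetrizable j
        fun i hi => unitIn_laurentRing_mutate_mutate hi).1)
  have hpT : p ∈ ((t.mutate k).mutate j).laurentRing := by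
    have : p = (p - 1) * (t.A j)⁻¹ * t.A j + 1 := by field_simp; ring
    rw [this]
    exact Subalgebra.add_mem _ (Subalgebra.mul_mem _ hp hyT) (Subalgebra.one_mem _)
  refine ht.mem_laurentRing_of_coprime hjk hpT hp0 hσ hσp hy (.inr hp) (fun f hf h => ?_) h₀ h₁ h₂
  have : f * (t.A j)⁻¹ = p * f * (t.A j)⁻¹ - (p - 1) * (t.A j)⁻¹ * f := by ring
  rw [this]
  exact Subalgebra.sub_mem _ h (Subalgebra.mul_mem _ hp hf)

/-- The exchange step behind the invariance of upper bounds. -/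
theorem IsFullRankSeed.mem_laurentRing_mutate_mutate {M : AmbientField K m n}
    (h₀ : M ∈ t.laurentRing) (h₁ : M ∈ (t.mutate k).laurentRing)
    (h₂ : M ∈ (t.mutate j).laurentRing) : M ∈ ((t.mutate k).mutate j).laurentRing := by
  have hB := ht.skewSymmetrizable
  have ht₁ := ht.mutate k
  have ht₃ := ht₁.mutate j
  have hu0 := ht.one_add_yhat_ne_zero k
  have huu := yhat_ne_zero ht.ne_zero k
  have hj0 := ht.ne_zero j
  have hmut := yhat_mutate ht.ne_zero hB hjk hu0
  have hz : ∀ i ≠ j, i ≠ k → UnitIn ((t.mutate k).mutate j).laurentRing (t.A i) := by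
    intro i hi hik
    have := unitIn_laurentRing_mutate_mutate (t := t) (k := k) hi
    rwa [mutate_A_of_ne hik] at this
  obtain ⟨w, hw, hw0, hjw⟩ := ht.exists_unit_mul_eq hjk
  have hv := unitIn_yhat ht₁.skewSymmetrizable j fun i hi =>
    unitIn_laurentRing_mutate_mutate (t := t) (k := k) hi
  have hyT : t.A j ∈ ((t.mutate k).mutate j).laurentRing := by
    rw [hjw]
    exact Subalgebra.mul_mem _ hw.1 (Subalgebra.add_mem _ (Subalgebra.one_mem _) hv.1)
  -- Separate the variable `A_j` in a monomial of `t` that does not involve `A_k`.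
  have hsep : ∀ e : Fin n → ℤ, e k = 0 → ∃ μ, UnitIn ((t.mutate k).mutate j).laurentRing μ ∧
      μ ≠ 0 ∧ ∏ i, t.A i ^ e i = μ * t.A j ^ e j := by
    intro e he
    refine ⟨∏ i, t.A i ^ (Function.update e j 0 i), unitIn_prod_zpow fun i hi => ?_,
      Finset.prod_ne_zero_iff.mpr fun i _ => zpow_ne_zero _ (ht.ne_zero i), ?_⟩
    · have hij : i ≠ j := by rintro rfl; simp at hi
      rw [Function.update_of_ne hij] at hi
      exact hz i hij (by rintro rfl; exact hi he)
    · rw [← Finset.prod_erase_mul _ _ (Finset.mem_univ j),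
        ← Finset.prod_erase_mul _ (fun i => t.A i ^ (Function.update e j 0 i)) (Finset.mem_univ j)]
      simp only [Function.update_self, zpow_zero, mul_one]
      congr 1
      refine Finset.prod_congr rfl fun i hi => ?_
      rw [Function.update_of_ne (Finset.ne_of_mem_erase hi)]
  obtain ⟨μ, hμ, hμ0, hμe⟩ := hsep (fun i => t.B i k) (hB.diag_eq_zero k)
  obtain ⟨ν, hν, hν0, hνe⟩ := hsep (fun i => ((-(t.B i k)).toNat : ℤ))
    (by simp [hB.diag_eq_zero k])
  have hc := unitIn_coeff ((t.mutate k).mutate j).laurentRing (t.X k)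
  have hu : t.yhat k = coeff K n (t.X k) * μ * t.A j ^ t.B j k := by
    rw [yhat, hμe, mul_assoc]
  have hP := exchangeBinomial_eq ht.ne_zero k
  have hs : t.secondTerm k = coeff K n (1 / Trop.oplus 1 (t.X k)) * ν *
      t.A j ^ (((-(t.B j k)).toNat : ℤ)) := by
    rw [secondTerm]
    simp only [← zpow_natCast]
    rw [hνe, mul_assoc]
  have hsgn := hB.nonneg_iff j k
  have hsgn' := hB.nonneg_iff k j
  rcases lt_trichotomy (t.B j k) 0 with hneg | hzero | hpos
  · have hb : 0 < t.B k j := by omega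
    refine ht.mem_laurentRing_of_sub_one_mul_mem hjk (p := 1 + (t.yhat k)⁻¹)
      (σ := t.secondTerm k * t.yhat k) (e := t.B k j) ?_ ?_ ?_ ?_ ?_ h₀ h₁ h₂
    · obtain ⟨d, hd⟩ : ∃ d : ℕ, t.B j k = -((d : ℤ) + 1) := ⟨(-t.B j k - 1).toNat, by omega⟩
      have : (1 + (t.yhat k)⁻¹ - 1) * (t.A j)⁻¹ = (coeff K n (t.X k) * μ)⁻¹ * t.A j ^ d := by
        rw [add_sub_cancel_left, hu, hd, zpow_neg, zpow_add₀ hj0, zpow_natCast, zpow_one]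
        field_simp
      rw [this]
      exact Subalgebra.mul_mem _ (hc.mul hμ).2 (Subalgebra.pow_mem _ hyT d)
    · have : 1 + (t.yhat k)⁻¹ = (1 + t.yhat k) * (t.yhat k)⁻¹ := by field_simp; ring
      rw [this]
      exact mul_ne_zero hu0 (inv_ne_zero huu)
    · have : t.secondTerm k * t.yhat k =
          coeff K n (1 / Trop.oplus 1 (t.X k)) * ν * (coeff K n (t.X k) * μ) := by
        rw [hs, hu, Int.toNat_of_nonneg (by omega), zpow_neg]
        field_simp
      rw [this]
      exact ((unitIn_coeff _ _).mul hν).mul (hc.mul hμ)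
    · rw [hP]; field_simp; ring
    · have : 1 + (t.yhat k)⁻¹ = (1 + t.yhat k) * (t.yhat k)⁻¹ := by field_simp; ring
      rw [hmut, this, mul_zpow, inv_zpow, max_eq_left hb.le, zpow_neg]
      field_simp
  · have hb : t.B k j = 0 := by omega
    have hyeq : (t.mutate k).yhat j = t.yhat j := by rw [hmut, hb]; simp
    have hmon : ∀ i, t.B j i = 0 → t.B k i = 0 →
        ((t.mutate k).mutate j).laurentMonomial ht₃.ne_zero (t.columnExponents i) = t.yhat i := by
      intro i hji hki
      refine congrArg (coeff K n (t.X i) * ·) (Finset.prod_congr rfl fun a _ => ?_)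
      change ((t.mutate k).mutate j).A a ^ t.B a i = t.A a ^ t.B a i
      by_cases haj : a = j
      · subst haj; rw [hji, zpow_zero, zpow_zero]
      by_cases hak : a = k
      · subst hak; rw [hki, zpow_zero, zpow_zero]
      rw [mutate_A_of_ne haj, mutate_A_of_ne hak]
    have hmonk := hmon k hzero (hB.diag_eq_zero k)
    have hmonj := hmon j (hB.diag_eq_zero j) hb
    obtain ⟨l, hl, hl'⟩ := ht.exists_grading hjk
    refine ht.mem_laurentRing_of_coprime hjk (p := 1 + t.yhat k) (σ := t.secondTerm k) (e := 0)
      ?_ hu0 ?_ hP (by rw [hyeq, zpow_zero, mul_one]) (.inl rfl) ?_ h₀ h₁ h₂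
    · rw [hu, hzero, zpow_zero, mul_one]
      exact Subalgebra.add_mem _ (Subalgebra.one_mem _) (hc.mul hμ).1
    · rw [hs, hzero]
      simpa using (unitIn_coeff _ _).mul hν
    · intro f hf h
      have hinv : (t.A j)⁻¹ = (1 + t.yhat j)⁻¹ * w⁻¹ := by rw [hjw, hyeq, mul_inv, mul_comm]
      rw [hinv, ← mul_assoc] at h ⊢
      rw [mul_comm, hw.inv.mul_mem_iff (inv_ne_zero hw0)] at h ⊢
      rw [← hmonj] at h ⊢
      rw [← hmonk] at h
      exact ht₃.mul_inv_mem_laurentRing l hl hl' (ht.columnExponents_ne_one j) hf h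
  · have hb : t.B k j < 0 := by omega
    refine ht.mem_laurentRing_of_sub_one_mul_mem hjk (p := 1 + t.yhat k)
      (σ := t.secondTerm k) (e := t.B k j) ?_ hu0 ?_ hP ?_ h₀ h₁ h₂
    · obtain ⟨d, hd⟩ : ∃ d : ℕ, t.B j k = (d : ℤ) + 1 := ⟨(t.B j k - 1).toNat, by omega⟩
      have : (1 + t.yhat k - 1) * (t.A j)⁻¹ = coeff K n (t.X k) * μ * t.A j ^ d := by
        rw [add_sub_cancel_left, hu, hd, zpow_add₀ hj0, zpow_natCast, zpow_one]
        field_simp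
      rw [this]
      exact Subalgebra.mul_mem _ (hc.mul hμ).1 (Subalgebra.pow_mem _ hyT d)
    · rw [hs, Int.toNat_of_nonpos (by omega)]
      simpa using (unitIn_coeff _ _).mul hν
    · rw [hmut, max_eq_right hb.le, zpow_zero, mul_one, zpow_neg]
      field_simp

end Exchange

/-- The upper bound `𝓛(t) ∩ ⋂_k 𝓛(μ_k t)` of a seed. -/
def upperBound (t : SeedData K m n) : Subalgebra (CoeffRing K m) (AmbientField K m n) :=
  t.laurentRing ⊓ ⨅ k, (t.mutate k).laurentRing

theorem mem_upperBound {M : AmbientField K m n} :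
    M ∈ t.upperBound ↔ M ∈ t.laurentRing ∧ ∀ k, M ∈ (t.mutate k).laurentRing := by
  rw [upperBound, Algebra.mem_inf, Algebra.mem_iInf]

theorem IsFullRankSeed.upperBound_le_mutate (ht : t.IsFullRankSeed) (k : Fin n) :
    t.upperBound ≤ (t.mutate k).upperBound := by
  intro M hM
  obtain ⟨h₀, h⟩ := mem_upperBound.mp hM
  refine mem_upperBound.mpr ⟨h k, fun j => ?_⟩
  by_cases hj : j = k
  · subst hj; rwa [ht.mutate_mutate]
  · exact ht.mem_laurentRing_mutate_mutate hj h₀ (h k) (h j)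

theorem IsFullRankSeed.upperBound_mutate (ht : t.IsFullRankSeed) (k : Fin n) :
    (t.mutate k).upperBound = t.upperBound := by
  refine le_antisymm ?_ (ht.upperBound_le_mutate k)
  conv_rhs => rw [← ht.mutate_mutate k]
  exact (ht.mutate k).upperBound_le_mutate k

theorem IsFullRankSeed.upperBound_eq_of_isSeedOf {s : SeedData K m n} (hs : s.IsFullRankSeed)
    (h : s.IsSeedOf t) : t.upperBound = s.upperBound := by
  induction h with
  | refl => rfl
  | tail h' h ih =>
    obtain ⟨k, rfl⟩ := h
    rw [(hs.of_isSeedOf h').upperBound_mutate, ih]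

/-- The upper cluster algebra is the upper bound of any of its seeds. -/
theorem IsFullRankSeed.upperClusterAlgebra_eq_upperBound {s : SeedData K m n}
    (hs : s.IsFullRankSeed) (h : s.IsSeedOf t) : s.upperClusterAlgebra = t.upperBound := by
  refine le_antisymm (fun M hM => ?_) (le_iInf fun u M hM => ?_)
  · rw [upperClusterAlgebra, Algebra.mem_iInf] at hM
    exact mem_upperBound.mpr ⟨hM ⟨t, h⟩, fun k => hM ⟨t.mutate k, h.tail ⟨k, rfl⟩⟩⟩
  · rw [hs.upperBound_eq_of_isSeedOf h, ← hs.upperBound_eq_of_isSeedOf u.2] at hM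
    exact (mem_upperBound.mp hM).1

/-! ### Divisibility by cluster variables -/

theorem monomial_ne_zero (hA : ∀ i, t.A i ≠ 0) (e : Fin n → ℕ) : t.monomial e ≠ 0 :=
  Finset.prod_ne_zero_iff.mpr fun i _ => pow_ne_zero _ (hA i)

theorem monomial_add {K : Type*} [CommRing K] {m n : ℕ} {t : SeedData K m n} (e d : Fin n → ℕ) :
    t.monomial (e + d) = t.monomial e * t.monomial d := by
  simp only [monomial, Pi.add_apply, pow_add, Finset.prod_mul_distrib]

theorem monomial_single {K : Type*} [CommRing K] {m n : ℕ} {t : SeedData K m n}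
    (k : Fin n) (d : ℕ) : t.monomial (Pi.single k d) = t.A k ^ d := by
  rw [monomial, Finset.prod_eq_single k]
  · rw [Pi.single_eq_same]
  · intro i _ hi; rw [Pi.single_eq_of_ne hi, pow_zero]
  · exact fun h => absurd (Finset.mem_univ k) h

theorem unitIn_monomial_laurentRing (e : Fin n → ℕ) : UnitIn t.laurentRing (t.monomial e) :=
  UnitIn.prod fun i _ => (t.unitIn_laurentRing i).pow _

theorem unitIn_laurentRing_mutate {i k : Fin n} (h : i ≠ k) :
    UnitIn (t.mutate k).laurentRing (t.A i) := by
  rw [← mutate_A_of_ne h]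
  exact unitIn_laurentRing _ i

theorem IsFullRankSeed.A_mem_upperBound (ht : t.IsFullRankSeed) (i : Fin n) :
    t.A i ∈ t.upperBound := by
  refine mem_upperBound.mpr ⟨(t.unitIn_laurentRing i).1, fun k => ?_⟩
  by_cases h : i = k
  · subst h
    have hP := ht.exchangeBinomial_ne_zero i
    have hA := ht.ne_zero i
    have : t.A i = t.exchangeBinomial i * ((t.mutate i).A i)⁻¹ := by
      rw [mutate_A_self]; field_simp
    rw [this]
    exact Subalgebra.mul_mem _ (exchangeBinomial_mem ht.skewSymmetrizable i
      fun a ha => (unitIn_laurentRing_mutate ha).1) (unitIn_laurentRing _ i).2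
  · exact (unitIn_laurentRing_mutate h).1

theorem IsFullRankSeed.monomial_mem_upperBound (ht : t.IsFullRankSeed) (e : Fin n → ℕ) :
    t.monomial e ∈ t.upperBound :=
  Subalgebra.prod_mem _ fun i _ => Subalgebra.pow_mem _ (ht.A_mem_upperBound i) _

/-- In `𝓛(μ_k t)` only the `k`-th factor of a cluster monomial of `t` is not a unit. -/
theorem div_monomial_mem_laurentRing_mutate (hA : ∀ i, t.A i ≠ 0) (e : Fin n → ℕ) (k : Fin n)
    {M : AmbientField K m n} :
    M / t.monomial e ∈ (t.mutate k).laurentRing ↔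
      M / t.A k ^ e k ∈ (t.mutate k).laurentRing := by
  have hunit : UnitIn (t.mutate k).laurentRing (∏ i ∈ Finset.univ.erase k, t.A i ^ e i)⁻¹ :=
    (UnitIn.prod fun i hi => (unitIn_laurentRing_mutate (Finset.ne_of_mem_erase hi)).pow _).inv
  have hne : (∏ i ∈ Finset.univ.erase k, t.A i ^ e i)⁻¹ ≠ 0 :=
    inv_ne_zero (Finset.prod_ne_zero_iff.mpr fun i _ => pow_ne_zero _ (hA i))
  rw [← hunit.mul_mem_iff (y := M / t.A k ^ e k) hne, monomial,
    ← Finset.prod_erase_mul _ _ (Finset.mem_univ k)]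
  rw [div_mul_eq_div_div, div_eq_mul_inv _ (∏ i ∈ Finset.univ.erase k, t.A i ^ e i),
    mul_comm M, mul_div_assoc]

/-- Divisibility by a cluster monomial can be tested on the powers of the single cluster
variables. -/
theorem IsFullRankSeed.div_monomial_mem_upperBound_iff (ht : t.IsFullRankSeed)
    {M : AmbientField K m n} (hM : M ∈ t.upperBound) (e : Fin n → ℕ) :
    M / t.monomial e ∈ t.upperBound ↔ ∀ k, M / t.A k ^ e k ∈ t.upperBound := by
  obtain ⟨h₀, h⟩ := mem_upperBound.mp hM
  have hL : ∀ e : Fin n → ℕ, M / t.monomial e ∈ t.laurentRing := fun e => by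
    rw [div_eq_mul_inv]
    exact Subalgebra.mul_mem _ h₀ (unitIn_monomial_laurentRing e).2
  have hk : ∀ k, M / t.A k ^ e k ∈ t.upperBound ↔
      M / t.A k ^ e k ∈ (t.mutate k).laurentRing := by
    intro k
    refine ⟨fun hk => (mem_upperBound.mp hk).2 k, fun hk => mem_upperBound.mpr ⟨?_, fun i => ?_⟩⟩
    · rw [← monomial_single]; exact hL _
    · by_cases hi : i = k
      · subst hi; exact hk
      · rw [div_eq_mul_inv]
        exact Subalgebra.mul_mem _ (h i)
          ((unitIn_laurentRing_mutate (Ne.symm hi)).pow _).2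
  simp only [hk, ← div_monomial_mem_laurentRing_mutate ht.ne_zero e]
  exact ⟨fun h' => (mem_upperBound.mp h').2, fun h' => mem_upperBound.mpr ⟨hL e, h'⟩⟩

/-- In `𝓛(μ_k t)` the cluster variable `A_k` is a genuine binomial, up to a unit. -/
theorem IsFullRankSeed.inv_A_notMem_laurentRing_mutate (ht : t.IsFullRankSeed) (k : Fin n) :
    (t.A k)⁻¹ ∉ (t.mutate k).laurentRing := by
  intro hmem
  have ht' := ht.mutate k
  have hkk := ht.skewSymmetrizable.diag_eq_zero k
  have hu0 := ht.one_add_yhat_ne_zero k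
  have hAk := ht.ne_zero k
  have hs := secondTerm_ne_zero ht.ne_zero k
  have hmon : (t.mutate k).laurentHom ht'.ne_zero
      (1 + MonoidAlgebra.of K _ (t.columnExponents k)) = 1 + t.yhat k := by
    rw [map_add, map_one, laurentHom_of]
    refine congrArg (fun x => 1 + coeff K n (t.X k) * x) (Finset.prod_congr rfl fun i _ => ?_)
    change (t.mutate k).A i ^ t.B i k = t.A i ^ t.B i k
    by_cases hi : i = k
    · subst hi; rw [hkk, zpow_zero, zpow_zero]
    · rw [mutate_A_of_ne hi]
  have hinv : (1 + t.yhat k)⁻¹ ∈ (t.mutate k).laurentRing := by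
    have : (1 + t.yhat k)⁻¹ = t.secondTerm k * ((t.mutate k).A k)⁻¹ * (t.A k)⁻¹ := by
      rw [mutate_A_self, exchangeBinomial_eq ht.ne_zero]; field_simp
    rw [this]
    exact Subalgebra.mul_mem _ (Subalgebra.mul_mem _
      (unitIn_secondTerm ht.skewSymmetrizable k fun i hi => unitIn_laurentRing_mutate hi).1
      (unitIn_laurentRing _ k).2) hmem
  obtain ⟨h, hh⟩ := (mem_laurentRing_iff _ ht'.ne_zero).mp hinv
  refine not_isUnit_one_add_of (K := K) (ht.columnExponents_ne_one k)
    (IsUnit.of_mul_eq_one h ((t.mutate k).laurentHom_injective ht'.ne_zero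
      ht'.algebraicIndependent ?_))
  rw [map_mul, hmon, hh, map_one, mul_inv_cancel₀ hu0]

/-- A nonzero element of `𝓛(μ_k t)` is divisible by only finitely many powers of `A_k`, by Krull's
intersection theorem. -/
theorem IsFullRankSeed.exists_div_pow_notMem [IsNoetherianRing K] (ht : t.IsFullRankSeed)
    (k : Fin n) {M : AmbientField K m n} (hM0 : M ≠ 0) : ∃ d : ℕ, M / t.A k ^ d ∉ t.upperBound := by
  by_contra! hcon
  have ht' := ht.mutate k
  have hmem : ∀ d, ∃ f, (t.mutate k).laurentHom ht'.ne_zero f = M / t.A k ^ d := fun d =>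
    (mem_laurentRing_iff _ ht'.ne_zero).mp ((mem_upperBound.mp (hcon d)).2 k)
  obtain ⟨g, hg⟩ := (mem_laurentRing_iff _ ht'.ne_zero).mp
    ((mem_upperBound.mp (ht.A_mem_upperBound k)).2 k)
  choose f hf using hmem
  have hinj := (t.mutate k).laurentHom_injective ht'.ne_zero ht'.algebraicIndependent
  have hgu : ¬ IsUnit g := by
    rintro ⟨u, rfl⟩
    refine ht.inv_A_notMem_laurentRing_mutate k ((mem_laurentRing_iff _ ht'.ne_zero).mpr
      ⟨(u⁻¹ : (MonoidAlgebra K (Exponents m n))ˣ), eq_inv_of_mul_eq_one_left ?_⟩)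
    rw [← hg, ← map_mul, Units.inv_mul, map_one]
  have := isNoetherianRing_groupAlgebra (K := K) (σ := Fin n ⊕ Fin m)
  have hI : Ideal.span {g} ≠ ⊤ := by rwa [Ne, Ideal.span_singleton_eq_top]
  have hf0 : f 0 ∈ (⨅ d : ℕ, Ideal.span {g} ^ d) := by
    rw [Ideal.mem_iInf]
    intro d
    rw [Ideal.span_singleton_pow, Ideal.mem_span_singleton]
    refine ⟨f d, hinj ?_⟩
    have hA := ht.ne_zero k
    rw [map_mul, map_pow, hg, hf, hf]
    field_simp
  rw [Ideal.iInf_pow_eq_bot_of_isDomain _ hI, Ideal.mem_bot] at hf0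
  have := hf 0
  rw [hf0, map_zero, pow_zero, div_one] at this
  exact hM0 this.symm

theorem IsFullRankSeed.exists_multiplicity [IsNoetherianRing K] (ht : t.IsFullRankSeed)
    (k : Fin n) {M : AmbientField K m n} (hM : M ∈ t.upperBound) (hM0 : M ≠ 0) :
    ∃ ν : ℕ, ∀ d : ℕ, M / t.A k ^ d ∈ t.upperBound ↔ d ≤ ν := by
  classical
  have hex := ht.exists_div_pow_notMem k hM0
  have hA := ht.ne_zero k
  have hpos : Nat.find hex ≠ 0 := by
    intro h
    have := Nat.find_spec hex
    rw [h] at this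
    exact this (by simpa using hM)
  have hmono : ∀ d e : ℕ, d ≤ e → M / t.A k ^ e ∈ t.upperBound →
      M / t.A k ^ d ∈ t.upperBound := by
    intro d e hde he
    obtain ⟨c, rfl⟩ := Nat.exists_eq_add_of_le hde
    have : M / t.A k ^ d = M / t.A k ^ (d + c) * t.A k ^ c := by
      rw [pow_add]; field_simp
    rw [this]
    exact Subalgebra.mul_mem _ he (Subalgebra.pow_mem _ (ht.A_mem_upperBound k) c)
  refine ⟨Nat.find hex - 1, fun d => ⟨fun hd => ?_, fun hd => ?_⟩⟩
  · by_contra! hlt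
    exact Nat.find_spec hex (hmono _ d (by omega) hd)
  · by_contra hnot
    have := Nat.find_min' hex hnot
    omega

end SeedData

open SeedData

theorem valuationPairing_eq {U : Subalgebra (CoeffRing K m) (AmbientField K m n)}
    {a M : AmbientField K m n} {ν : ℕ} (h : ∀ d : ℕ, M / a ^ d ∈ U ↔ d ≤ ν) :
    valuationPairing U a M = ν := by
  refine le_antisymm (iSup₂_le fun d hd => ?_) ?_
  · exact_mod_cast (h d).mp hd
  · exact le_iSup₂ (f := fun (d : ℕ) (_ : M / a ^ d ∈ U) => (d : ℕ∞)) ν ((h ν).mpr le_rfl)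

/-- `M = A ^ e * L` is a local factorization exactly when every exponent is the multiplicity of the
corresponding cluster variable in `M`. -/
theorem isLocalFactorization_iff {t : SeedData K m n} (ht : t.IsFullRankSeed)
    {M L : AmbientField K m n} (hM : M ∈ t.upperBound) {ν : Fin n → ℕ}
    (hν : ∀ k (d : ℕ), M / t.A k ^ d ∈ t.upperBound ↔ d ≤ ν k) (e : Fin n → ℕ) :
    IsLocalFactorization t.upperBound t M (t.monomial e) L ↔ e = ν ∧ L = M / t.monomial e := by
  have hne := monomial_ne_zero ht.ne_zero
  have hdiv := ht.div_monomial_mem_upperBound_iff hM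
  have hsucc : ∀ k, M / t.monomial e / t.A k = M / t.monomial (e + Pi.single k 1) := by
    intro k
    rw [monomial_add, monomial_single, pow_one, div_div]
  constructor
  · intro h
    have hL : L = M / t.monomial e := by rw [h.eq_mul]; field_simp [hne e]
    refine ⟨funext fun k => le_antisymm ?_ ?_, hL⟩
    · exact (hν k _).mp ((hdiv e).mp (hL ▸ h.mem_right) k)
    · by_contra! hlt
      apply h.not_dvd k
      rw [hL, hsucc, hdiv]
      intro i
      rw [hν]
      by_cases hi : i = k
      · subst hi; simpa using hlt
      · rw [Pi.add_apply, Pi.single_eq_of_ne hi, add_zero, ← hν]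
        exact (hdiv e).mp (hL ▸ h.mem_right) i
  · rintro ⟨rfl, rfl⟩
    refine ⟨by field_simp [hne e], ht.monomial_mem_upperBound e,
      (hdiv e).mpr fun k => (hν k _).mpr le_rfl, ⟨e, rfl⟩, fun k hk => ?_⟩
    rw [hsucc, hdiv] at hk
    have := (hν k _).mp (hk k)
    simp at this

end

end ClusterAlg

open ClusterAlg ClusterAlg.SeedData in
theorem theorem3p6 {K : Type*} [CommRing K] [IsDomain K]
    (hK : (IsField K ∧ CharZero K) ∨ Nonempty (K ≃+* ℤ)) {m n : ℕ}
    (s : ClusterAlg.SeedData K m n) (hs : s.IsSeed) (hrank : s.FullRank)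
    (t₀ : ClusterAlg.SeedData K m n) (ht₀ : s.IsSeedOf t₀)
    (M : ClusterAlg.AmbientField K m n) (hM : M ∈ s.upperClusterAlgebra) (hM0 : M ≠ 0) :
    (∃! p : ClusterAlg.AmbientField K m n × ClusterAlg.AmbientField K m n,
      ClusterAlg.IsLocalFactorization s.upperClusterAlgebra t₀ M p.1 p.2) ∧
    (∀ (e : Fin n → ℕ) (L : ClusterAlg.AmbientField K m n),
      ClusterAlg.IsLocalFactorization s.upperClusterAlgebra t₀ M (t₀.monomial e) L →
        ∀ k, (e k : ℕ∞) = ClusterAlg.valuationPairing s.upperClusterAlgebra (t₀.A k) M) := by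
  have : IsNoetherianRing K := by
    rcases hK with ⟨hK, -⟩ | ⟨⟨φ⟩⟩
    · let _ := hK.toField
      infer_instance
    · exact isNoetherianRing_of_ringEquiv ℤ φ.symm
  have hs' := hs.isFullRankSeed hrank
  have ht := hs'.of_isSeedOf ht₀
  rw [hs'.upperClusterAlgebra_eq_upperBound ht₀] at hM ⊢
  choose ν hν using fun k => ht.exists_multiplicity k hM hM0
  have hiff := fun e L => isLocalFactorization_iff ht (L := L) hM hν e
  refine ⟨⟨(t₀.monomial ν, M / t₀.monomial ν), (hiff _ _).mpr ⟨rfl, rfl⟩, ?_⟩, ?_⟩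
  · rintro ⟨N, L⟩ hNL
    obtain ⟨e, he⟩ := hNL.isClusterMonomial
    change N = t₀.monomial e at he
    subst he
    obtain ⟨rfl, hL⟩ := (hiff e L).mp hNL
    rw [hL]
  · intro e L hL k
    rw [valuationPairing_eq (hν k), ((hiff e L).mp hL).1]
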